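/- For integers $m,n\ge 1$, the $m\times n$ projective checkerboard $\mathcal{B}_{m,n}$ is the digraph whose vertices (called squares) are the pairs $(p,q)$ of integers with $0\le p\le m-1$ and $0\le q\le n-1$, with a directed edge from each square $\sigma$ to $\sigma E$ and to $\sigma N$, where $$(p,q)E=\begin{cases}(p+1,q)&\text{if } p<m-1,\\(0,n-1-q)&\text{if } p=m-1,\end{cases}\qquad (p,q)N=\begin{cases}(p,q+1)&\text{if } q<n-1,\\(m-1-p,0)&\text{if } q=n-1.\end{cases}$$ A hamiltonian path is a directed path that visits every square exactly once; its terminal square is its last square. Theorem. Assume $m\ge n\ge 3$. For a square $(x,y)$ of $\mathcal{B}_{m,n}$, there is a hamiltonian path in $\mathcal{B}_{m,n}$ whose terminal square is $(x,y)$ if and only if at least one of the following holds: 1. $x=m-1$ and $0\le y\le\lfloor n/2\rfloor$; 2. $0\le x\le m-\lfloor (n+1)/2\rfloor$ and $y=n-1$; 3. $0\le x\le\lfloor m/2\rfloor-1$ and $y=\lfloor (n-1)/2\rfloor$; 4. $m-\lfloor n/2\rfloor-1\le x\le m-1$ and $y=\lfloor n/2\rfloor$; 5. $\lfloor (n-1)/2\rfloor\le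 x\le\lfloor (m-1)/2\rfloor$ and $0\le y\le\lfloor (n-1)/2\rfloor-1$; 6. $\lfloor m/2\rfloor\le x\le m-\lfloor (n+1)/2\rfloor$ and $\lfloor (n-1)/2\rfloor\le y\le n-1$. -/

import Mathlib

/-- The move to the east: `(p, q)E = (p + 1, q)` if `p < m - 1`, and `(m - 1, q)E = (0, n - 1 - q)`.
(`Fin.rev q` is `n - 1 - q`.) -/
def moveEast {m n : ℕ} (s : Fin m × Fin n) : Fin m × Fin n :=
  if h : (s.1 : ℕ) + 1 < m then (⟨s.1 + 1, h⟩, s.2)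
  else (⟨0, s.1.pos⟩, Fin.rev s.2)

/-- The move to the north: `(p, q)N = (p, q + 1)` if `q < n - 1`, and
`(p, n - 1)N = (m - 1 - p, 0)`. -/
def moveNorth {m n : ℕ} (s : Fin m × Fin n) : Fin m × Fin n :=
  if h : (s.2 : ℕ) + 1 < n then (s.1, ⟨s.2 + 1, h⟩)
  else (Fin.rev s.1, ⟨0, s.2.pos⟩)

/-- The `m × n` projective checkerboard: the digraph whose vertices are the squares `(p, q)` with
`0 ≤ p ≤ m - 1` and `0 ≤ q ≤ n - 1`, with a directed edge from each square to its east move and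
to its north move. -/
def projectiveCheckerboard (m n : ℕ) : Digraph (Fin m × Fin n) where
  Adj s t := t = moveEast s ∨ t = moveNorth s

/-- A list of vertices is a hamiltonian path of the digraph `G` if consecutive vertices are joined
by a directed edge and each vertex of `G` is visited exactly once. -/
def IsHamiltonianPath {V : Type*} (G : Digraph V) (l : List V) : Prop :=
  l.IsChain G.Adj ∧ l.Nodup ∧ ∀ v : V, v ∈ l

/-! Pair the antidiagonal `p + q = i` with `m + n - 3 - i`. The two possible predecessors of a
square other than `(0, 0)` lie on one antidiagonal or, across an edge of the board, on two paired
ones.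

Sufficiency. Giving each pair of antidiagonals a common direction therefore yields a permutation of
the board. If a run of squares on one antidiagonal meets each of its cycles once, letting all
squares of the run but the first take the other move splices the cycles into a hamiltonian path
ending at that first square (`exists_path_of_run`). It suffices to send a band `a ≤ i < w / 2` and
its paired band north and all else east; `cycleInvariant` then separates the cycles exactly, and
each region of the theorem has its own band and run.

Necessity. No square is entered twice, so on a hamiltonian path paired antidiagonals share one
direction, except possibly on the two "rails": the antidiagonal of the terminal square and its
partner (`Ranking.east_iff`). Off the rails the half-turn of the board thus reverses the path: from
any square the path follows a prescribed lattice path, or leaves the board and comes back, along the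
rotated route, to the opposite square (`Ranking.rank_trace`). Between the rails this matches the
squares just above the lower rail with squares of the upper rail by a reflection depending only on
the number of north antidiagonals in between (`TwoRails.mirrored`). Beyond the upper rail the path
returns to the lower one with row shift 0, 1 or -1. Two such excursions must not close into a cycle,
which determines the row of the terminal square up to a few choices (`Mirrored.star_eq_of_minus`,
`Mirrored.star_eq_of_plus`). Bounds on the number of north antidiagonals finish the proof
(`TwoRails.terminal_mem`). When the terminal antidiagonal is its own partner there is one rail and
the argument is shorter. -/

/-- The square with integer coordinates `(p, q)`, reduced modulo the side lengths. -/
def square (m n : ℕ) [NeZero m] [NeZero n] (p q : ℤ) : Fin m × Fin n :=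
  (Fin.ofNat m p.toNat, Fin.ofNat n q.toNat)

/-- The integer coordinates `(p, q)` lie on the `m × n` board. -/
def OnBoard (m n : ℕ) (p q : ℤ) : Prop := 0 ≤ p ∧ p < m ∧ 0 ≤ q ∧ q < n

theorem onBoard_coe {m n : ℕ} (v : Fin m × Fin n) : OnBoard m n (v.1 : ℕ) (v.2 : ℕ) := by
  have := v.1.2
  have := v.2.2
  unfold OnBoard
  omega

/-! ### The moves in integer coordinates -/

section Square

variable {m n : ℕ} [NeZero m] [NeZero n]

theorem square_coe (v : Fin m × Fin n) : square m n (v.1 : ℕ) (v.2 : ℕ) = v := by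
  ext <;> simp [square]

theorem square_fst {p q : ℤ} (h : OnBoard m n p q) : (((square m n p q).1 : ℕ) : ℤ) = p := by
  obtain ⟨h1, h2, -, -⟩ := h
  have : (square m n p q).1.val = p.toNat % m := rfl
  rw [this, Nat.mod_eq_of_lt (by omega)]
  omega

theorem square_snd {p q : ℤ} (h : OnBoard m n p q) : (((square m n p q).2 : ℕ) : ℤ) = q := by
  obtain ⟨-, -, h1, h2⟩ := h
  have : (square m n p q).2.val = q.toNat % n := rfl
  rw [this, Nat.mod_eq_of_lt (by omega)]
  omega

theorem eq_square {v : Fin m × Fin n} {p q : ℤ} (h1 : ((v.1 : ℕ) : ℤ) = p)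
    (h2 : ((v.2 : ℕ) : ℤ) = q) : v = square m n p q := by
  rw [← h1, ← h2, square_coe]

theorem square_inj {p q p' q' : ℤ} (h : OnBoard m n p q) (h' : OnBoard m n p' q')
    (e : square m n p q = square m n p' q') : p = p' ∧ q = q' := by
  exact ⟨by rw [← square_fst h, e, square_fst h'], by rw [← square_snd h, e, square_snd h']⟩

theorem moveEast_square {p q : ℤ} (h : OnBoard m n p q) (hp : p + 1 < m) :
    moveEast (square m n p q) = square m n (p + 1) q := by
  have h1 := square_fst h
  have h2 := square_snd h
  apply eq_square <;> unfold moveEast <;> rw [dif_pos (by omega)]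
  · simp [h1]
  · simpa using h2

theorem moveEast_square_last {q : ℤ} (h : OnBoard m n (m - 1) q) :
    moveEast (square m n (m - 1) q) = square m n 0 (n - 1 - q) := by
  have h1 := square_fst h
  have h2 := square_snd h
  apply eq_square <;> unfold moveEast <;> rw [dif_neg (by omega)]
  · simp
  · have := (square m n (m - 1) q).2.2
    simp only [Fin.val_rev]
    omega

theorem moveNorth_square {p q : ℤ} (h : OnBoard m n p q) (hq : q + 1 < n) :
    moveNorth (square m n p q) = square m n p (q + 1) := by
  have h1 := square_fst h
  have h2 := square_snd h
  apply eq_square <;> unfold moveNorth <;> rw [dif_pos (by omega)]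
  · simpa using h1
  · simp [h2]

theorem moveNorth_square_last {p : ℤ} (h : OnBoard m n p (n - 1)) :
    moveNorth (square m n p (n - 1)) = square m n (m - 1 - p) 0 := by
  have h1 := square_fst h
  have h2 := square_snd h
  apply eq_square <;> unfold moveNorth <;> rw [dif_neg (by omega)]
  · have := (square m n p (n - 1)).1.2
    simp only [Fin.val_rev]
    omega
  · simp

end Square

/-! ### Splicing the cycles of a permutation into a path -/

section Merge

variable {V : Type*} [Finite V]

theorem exists_list_of_cycle (g : Equiv.Perm V) (x : V) :
    ∃ l : List V, l.IsChain (fun a b => b = g a) ∧ l.Nodup ∧ (∀ v, v ∈ l ↔ g.SameCycle x v) ∧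
      l.head? = some (g x) ∧ l.getLast? = some x := by
  have hpos : 0 < Function.minimalPeriod g x :=
    Function.minimalPeriod_pos_of_mem_periodicPts (g.injective.mem_periodicPts x)
  have hmod := fun i => Function.iterate_mod_minimalPeriod_eq (f := g) (x := x) (n := i)
  have hinj := Function.iterate_injOn_Iio_minimalPeriod (f := g) (x := x)
  have hper : g^[Function.minimalPeriod g x] x = x := Function.iterate_minimalPeriod
  obtain ⟨N, hN⟩ : ∃ N, Function.minimalPeriod g x = N + 1 :=
    ⟨_, (Nat.succ_pred_eq_of_pos hpos).symm⟩
  rw [hN] at hmod hinj hper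
  refine ⟨(List.range (N + 1)).map (fun i => g^[i + 1] x), ?_, ?_, ?_, ?_, ?_⟩
  · rw [List.isChain_map, List.isChain_range]
    intro i _
    rw [Function.iterate_succ_apply' g (i + 1)]
  · refine List.Nodup.map_on ?_ List.nodup_range
    intro i hi j hj hij
    rw [List.mem_range] at hi hj
    rw [Function.iterate_succ_apply', Function.iterate_succ_apply'] at hij
    exact hinj hi hj (g.injective hij)
  · intro v
    simp only [List.mem_map, List.mem_range]
    constructor
    · rintro ⟨i, -, rfl⟩
      exact ⟨(i + 1 : ℕ), by rw [zpow_natCast, Equiv.Perm.coe_pow]⟩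
    · intro h
      obtain ⟨i, hi⟩ := h.exists_nat_pow_eq
      -- The list holds `g^[j + 1] x`, so `j` must be `i - 1` modulo the period `N + 1`.
      refine ⟨(i + N) % (N + 1), Nat.mod_lt _ (by omega), ?_⟩
      rw [Function.iterate_succ_apply', hmod, ← Function.iterate_succ_apply' g,
        show (i + N).succ = i + (N + 1) from rfl, Function.iterate_add_apply, hper, ← hi,
        Equiv.Perm.coe_pow]
  · rw [List.range_succ_eq_map]
    simp
  · rw [List.range_succ]
    simpa using hper

/-- Open the cycle of each `σ j` just after `σ j`. The opened cycle of `σ (j + 1)` ends at `σ (j +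
1)`, from which `hlink` gives an edge to the start `g (σ j)` of the next one; the last to be
traversed ends at `σ 0`. -/
theorem exists_isHamiltonianPath_of_cycles (G : Digraph V) (g : Equiv.Perm V)
    (hg : ∀ v, G.Adj v (g v)) (σ : ℕ → V) (k : ℕ)
    (hlink : ∀ j < k, G.Adj (σ (j + 1)) (g (σ j)))
    (hdisj : ∀ i j, i < j → j ≤ k → ¬ g.SameCycle (σ i) (σ j))
    (hcover : ∀ v, ∃ j ≤ k, g.SameCycle (σ j) v) :
    ∃ l : List V, IsHamiltonianPath G l ∧ l.getLast? = some (σ 0) := by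
  have key : ∀ j ≤ k, ∃ l : List V, l.IsChain G.Adj ∧ l.Nodup ∧
      (∀ v, v ∈ l ↔ ∃ i ≤ j, g.SameCycle (σ i) v) ∧
      l.head? = some (g (σ j)) ∧ l.getLast? = some (σ 0) := by
    intro j
    induction j with
    | zero =>
      intro _
      obtain ⟨l, h1, h2, h3, h4, h5⟩ := exists_list_of_cycle g (σ 0)
      refine ⟨l, h1.imp (by rintro a b rfl; exact hg a), h2, ?_, h4, h5⟩
      intro v
      simp [h3]
    | succ j ih =>
      intro hj
      obtain ⟨l, h1, h2, h3, h4, h5⟩ := ih (by omega)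
      obtain ⟨l', h1', h2', h3', h4', h5'⟩ := exists_list_of_cycle g (σ (j + 1))
      refine ⟨l' ++ l, ?_, ?_, ?_, ?_, ?_⟩
      · refine (h1'.imp (by rintro a b rfl; exact hg a)).append h1 ?_
        intro a ha b hb
        rw [h5', Option.mem_some_iff] at ha
        rw [h4, Option.mem_some_iff] at hb
        rw [← ha, ← hb]
        exact hlink j (by omega)
      · refine h2'.append h2 ?_
        intro v hv hv'
        obtain ⟨i, hi, hiv⟩ := (h3 v).1 hv'
        exact hdisj i (j + 1) (by omega) hj (hiv.trans ((h3' v).1 hv).symm)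
      · intro v
        rw [List.mem_append, h3, h3']
        constructor
        · rintro (h | ⟨i, hi, h⟩)
          · exact ⟨j + 1, le_rfl, h⟩
          · exact ⟨i, by omega, h⟩
        · rintro ⟨i, hi, h⟩
          rcases Nat.lt_or_ge j i with hij | hij
          · exact Or.inl (by rwa [show j + 1 = i by omega])
          · exact Or.inr ⟨i, hij, h⟩
      · rw [List.head?_append, h4']
        rfl
      · rw [List.getLast?_append, h5]
        rfl
  obtain ⟨l, h1, h2, h3, -, h5⟩ := key k le_rfl
  exact ⟨l, ⟨h1, h2, fun v => (h3 v).2 (hcover v)⟩, h5⟩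

end Merge

/-! ### The base permutations and the invariant of their cycles -/

section Base

theorem moveEast_coords {m n : ℕ} (v : Fin m × Fin n) :
    ((v.1 : ℕ) + 1 < m ∧ ((moveEast v).1 : ℕ) = v.1 + 1 ∧ ((moveEast v).2 : ℕ) = v.2) ∨
      ((v.1 : ℕ) + 1 = m ∧ ((moveEast v).1 : ℕ) = 0 ∧ ((moveEast v).2 : ℕ) + v.2 + 1 = n) := by
  have h1 := v.1.2
  have h2 := v.2.2
  unfold moveEast
  split_ifs with h
  · exact Or.inl ⟨h, rfl, rfl⟩
  · refine Or.inr ⟨by omega, rfl, ?_⟩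
    simp only [Fin.val_rev]
    omega

theorem moveNorth_coords {m n : ℕ} (v : Fin m × Fin n) :
    ((v.2 : ℕ) + 1 < n ∧ ((moveNorth v).1 : ℕ) = v.1 ∧ ((moveNorth v).2 : ℕ) = v.2 + 1) ∨
      ((v.2 : ℕ) + 1 = n ∧ ((moveNorth v).1 : ℕ) + v.1 + 1 = m ∧ ((moveNorth v).2 : ℕ) = 0) := by
  have h1 := v.1.2
  have h2 := v.2.2
  unfold moveNorth
  split_ifs with h
  · exact Or.inl ⟨h, rfl, rfl⟩
  · refine Or.inr ⟨by omega, ?_, rfl⟩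
    simp only [Fin.val_rev]
    omega

/-- Antidiagonals `p + q = i` with `a ≤ i < w / 2`, and those paired with them. -/
def NorthZone (m n : ℕ) (a w i : ℤ) : Prop :=
  (a ≤ i ∧ 2 * i < w) ∨ (a ≤ m + n - 3 - i ∧ 2 * (m + n - 3 - i) < w)

open Classical in
/-- Move north on the squares of the north zone and east on all others. -/
noncomputable def baseMove (m n : ℕ) (a w : ℤ) (v : Fin m × Fin n) : Fin m × Fin n :=
  if NorthZone m n a w ((v.1 : ℕ) + (v.2 : ℕ)) then moveNorth v else moveEast v

/-- A collision needs an east and a north predecessor of one square; these lie on equal or paired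
antidiagonals, and `NorthZone` is symmetric under the pairing. -/
theorem baseMove_injective (m n : ℕ) (a w : ℤ) : Function.Injective (baseMove m n a w) := by
  intro u v h
  have hu1 := u.1.2
  have hu2 := u.2.2
  have hv1 := v.1.2
  have hv2 := v.2.2
  have h1 := congrArg (fun s => (s.1 : ℕ)) h
  have h2 := congrArg (fun s => (s.2 : ℕ)) h
  have key : (u.1 : ℕ) = v.1 ∧ (u.2 : ℕ) = v.2 := by
    simp only [baseMove] at h1 h2
    have e1 := moveEast_coords u
    have e2 := moveEast_coords v
    have e3 := moveNorth_coords u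
    have e4 := moveNorth_coords v
    split_ifs at h1 h2 with c1 c2 c2 <;> unfold NorthZone at c1 c2
    · clear e1 e2; omega
    · clear e1 e4; rcases e2 with e2 | e2 <;> rcases e3 with e3 | e3 <;> omega
    · clear e2 e3; rcases e1 with e1 | e1 <;> rcases e4 with e4 | e4 <;> omega
    · clear e3 e4; omega
  ext
  · exact key.1
  · exact key.2

/-- `baseMove` as a permutation of the board. -/
noncomputable def basePerm (m n : ℕ) (a w : ℤ) : Equiv.Perm (Fin m × Fin n) :=
  Equiv.ofBijective (baseMove m n a w)
    (Finite.injective_iff_bijective.1 (baseMove_injective m n a w))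

theorem basePerm_apply (m n : ℕ) (a w : ℤ) (v : Fin m × Fin n) :
    basePerm m n a w v = baseMove m n a w v := rfl

theorem adj_basePerm (m n : ℕ) (a w : ℤ) (v : Fin m × Fin n) :
    (projectiveCheckerboard m n).Adj v (basePerm m n a w v) := by
  rw [basePerm_apply]
  unfold baseMove
  split_ifs
  · exact Or.inr rfl
  · exact Or.inl rfl

/-- Side conditions under which the cycles of the base permutation are understood. -/
structure Admissible (m n : ℕ) (a w : ℤ) : Prop where
  le : n ≤ m
  two_le : 2 ≤ n
  nonneg : 0 ≤ a
  low : 2 * a ≤ w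
  high : w ≤ m + n - 2
  large : n - 2 ≤ w
  parity : 2 ∣ w ∨ w = m + n - 2

/-- An invariant of the cycles of the base permutation. -/
def cycleInvariant (m n : ℕ) (a w p q : ℤ) : ℕ :=
  if p + q ≤ a then (2 * q - (n - 1 - w + 2 * a)).natAbs
  else if 2 * (p + q) ≤ w then (2 * p - (w - n + 1)).natAbs
  else if 2 * (p + q) ≤ 2 * (m + n - 2) - w then (2 * q - (n - 1)).natAbs
  else if p + q ≤ m + n - 2 - a then (2 * (m - 1 - p) - (w - n + 1)).natAbs
  else (2 * (n - 1 - q) - (n - 1 - w + 2 * a)).natAbs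

/-- In the low band a cycle keeps its column `p`, and the invariant is twice the distance of `p`
from the centre of the reflection `p ↦ w - n + 1 - p`. The other branches carry this value along: by
the row where the moves go east, by the column `m - 1 - p` in the upper band. -/
theorem cycleInvariant_apply {m n : ℕ} {a w : ℤ} (hA : Admissible m n a w) (v : Fin m × Fin n) :
    cycleInvariant m n a w ((basePerm m n a w v).1 : ℕ) ((basePerm m n a w v).2 : ℕ) =
      cycleInvariant m n a w (v.1 : ℕ) (v.2 : ℕ) := by
  obtain ⟨h1, h2, h3, h4, h5, h6, h7⟩ := hA
  have hv1 := v.1.2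
  have hv2 := v.2.2
  rw [basePerm_apply, baseMove]
  split_ifs with hz
  · have e := moveNorth_coords v
    generalize moveNorth v = u at e ⊢
    unfold NorthZone at hz
    unfold cycleInvariant
    rcases e with e | e <;> split_ifs <;> omega
  · have e := moveEast_coords v
    generalize moveEast v = u at e ⊢
    unfold NorthZone at hz
    unfold cycleInvariant
    rcases e with e | e <;> split_ifs <;> omega

variable {m n : ℕ} [NeZero m] [NeZero n] {a w : ℤ}

theorem basePerm_square_of_not {p q : ℤ} (h : OnBoard m n p q) (hz : ¬ NorthZone m n a w (p + q)) :
    basePerm m n a w (square m n p q) = moveEast (square m n p q) := by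
  rw [basePerm_apply]
  unfold baseMove
  rw [square_fst h, square_snd h, if_neg hz]

theorem basePerm_square {p q : ℤ} (h : OnBoard m n p q) (hz : NorthZone m n a w (p + q)) :
    basePerm m n a w (square m n p q) = moveNorth (square m n p q) := by
  rw [basePerm_apply]
  unfold baseMove
  rw [square_fst h, square_snd h, if_pos hz]

/-- The squares `(p, q)` and `(p', q')` lie on the same cycle of the base permutation. -/
def Linked (m n : ℕ) [NeZero m] [NeZero n] (a w p q p' q' : ℤ) : Prop :=
  (basePerm m n a w).SameCycle (square m n p q) (square m n p' q')

theorem Linked.symm {p q p' q' : ℤ} (h : Linked m n a w p q p' q') : Linked m n a w p' q' p q :=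
  Equiv.Perm.SameCycle.symm h

theorem Linked.trans {p q p' q' p'' q'' : ℤ} (h : Linked m n a w p q p' q')
    (h' : Linked m n a w p' q' p'' q'') : Linked m n a w p q p'' q'' :=
  Equiv.Perm.SameCycle.trans h h'

theorem Linked.refl (p q : ℤ) : Linked m n a w p q p q := Equiv.Perm.SameCycle.refl _ _

theorem linked_of_apply {p q p' q' : ℤ}
    (h : basePerm m n a w (square m n p q) = square m n p' q') : Linked m n a w p q p' q' :=
  ⟨1, by rw [zpow_one, h]⟩

theorem linked_row {p q : ℤ} (k : ℕ) (h : OnBoard m n p q) (hk : p + k < m)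
    (hz : ∀ i, p + q ≤ i → i < p + q + k → ¬ NorthZone m n a w i) :
    Linked m n a w p q (p + k) q := by
  induction k with
  | zero => simpa using Linked.refl p q
  | succ k ih =>
    unfold OnBoard at h
    push_cast at hk hz ⊢
    refine (ih (by omega) fun i h1 h2 => hz i h1 (by omega)).trans ?_
    have hb : OnBoard m n (p + k) q := by unfold OnBoard; omega
    apply linked_of_apply
    rw [basePerm_square_of_not hb (hz _ (by omega) (by omega)), moveEast_square hb (by omega)]
    congr 1
    ring

theorem linked_column {p q : ℤ} (k : ℕ) (h : OnBoard m n p q) (hk : q + k < n)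
    (hz : ∀ i, p + q ≤ i → i < p + q + k → NorthZone m n a w i) :
    Linked m n a w p q p (q + k) := by
  induction k with
  | zero => simpa using Linked.refl p q
  | succ k ih =>
    unfold OnBoard at h
    push_cast at hk hz ⊢
    refine (ih (by omega) fun i h1 h2 => hz i h1 (by omega)).trans ?_
    have hb : OnBoard m n p (q + k) := by unfold OnBoard; omega
    apply linked_of_apply
    rw [basePerm_square hb (hz _ (by omega) (by omega)), moveNorth_square hb (by omega)]
    congr 1
    ring

theorem linked_row' {p q p' : ℤ} (h : OnBoard m n p q) (h' : OnBoard m n p' q) (hp : p ≤ p')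
    (hz : ∀ i, p + q ≤ i → i < p' + q → ¬ NorthZone m n a w i) : Linked m n a w p q p' q := by
  have := linked_row (a := a) (w := w) (p' - p).toNat h (by unfold OnBoard at h h'; omega)
    (fun i h1 h2 => hz i h1 (by omega))
  rwa [show p + ((p' - p).toNat : ℤ) = p' by omega] at this

theorem linked_column' {p q q' : ℤ} (h : OnBoard m n p q) (h' : OnBoard m n p q') (hq : q ≤ q')
    (hz : ∀ i, p + q ≤ i → i < p + q' → NorthZone m n a w i) : Linked m n a w p q p q' := by
  have := linked_column (a := a) (w := w) (q' - q).toNat h (by unfold OnBoard at h h'; omega)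
    (fun i h1 h2 => hz i h1 (by omega))
  rwa [show q + ((q' - q).toNat : ℤ) = q' by omega] at this

theorem linked_exit_east {q : ℤ} (h : OnBoard m n (m - 1) q)
    (hz : ¬ NorthZone m n a w (m - 1 + q)) : Linked m n a w (m - 1) q 0 (n - 1 - q) := by
  apply linked_of_apply
  rw [basePerm_square_of_not h hz, moveEast_square_last h]

theorem linked_exit_north {p : ℤ} (h : OnBoard m n p (n - 1))
    (hz : NorthZone m n a w (p + (n - 1))) : Linked m n a w p (n - 1) (m - 1 - p) 0 := by
  apply linked_of_apply
  rw [basePerm_square h hz, moveNorth_square_last h]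

end Base

/-! ### Classification of the cycles, and paths from runs on an antidiagonal -/

section Engine

/-- On-board squares in the first zone where the base permutation moves north. -/
def LowZone (m n : ℕ) (a w p q : ℤ) : Prop := OnBoard m n p q ∧ a ≤ p + q ∧ 2 * (p + q) ≤ w

theorem cycleInvariant_lowZone {m n : ℕ} {a w p q : ℤ} (h : LowZone m n a w p q) :
    cycleInvariant m n a w p q = (2 * p - (w - n + 1)).natAbs := by
  unfold LowZone at h
  unfold cycleInvariant
  split_ifs <;> omega

variable {m n : ℕ} [NeZero m] [NeZero n] {a w : ℤ}

theorem linked_lowZone_of_le (hA : Admissible m n a w) {p q : ℤ} (h : OnBoard m n p q)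
    (hi : p + q ≤ a) : Linked m n a w p q (a - q) q ∧ LowZone m n a w (a - q) q := by
  obtain ⟨h1, h2, h3, h4, h5, h6, h7⟩ := hA
  refine ⟨linked_row' ?_ ?_ ?_ ?_, ?_⟩ <;>
    simp only [LowZone, OnBoard, NorthZone] at * <;> intros <;> omega

theorem linked_lowZone_of_upper (hA : Admissible m n a w) {p q : ℤ} (h : OnBoard m n p q)
    (hi : m + n - 2 - a ≤ p + q) :
    Linked m n a w p q (a - (n - 1 - q)) (n - 1 - q) ∧
      LowZone m n a w (a - (n - 1 - q)) (n - 1 - q) := by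
  have hA' := hA
  obtain ⟨h1, h2, h3, h4, h5, h6, h7⟩ := hA
  have e1 : Linked m n a w p q (m - 1) q := by
    apply linked_row' <;> simp only [OnBoard, NorthZone] at * <;> intros <;> omega
  have e2 : Linked m n a w (m - 1) q 0 (n - 1 - q) := by
    apply linked_exit_east <;> simp only [OnBoard, NorthZone] at * <;> omega
  have e3 := linked_lowZone_of_le hA' (p := 0) (q := n - 1 - q)
    (by unfold OnBoard at *; omega) (by unfold OnBoard at *; omega)
  exact ⟨(e1.trans e2).trans e3.1, e3.2⟩

/-- Climbing column `p`, the cycle leaves through the top edge, or first reaches the antidiagonal `m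
+ n - 2 - a` and leaves eastwards. Either way it next meets the low zone in column `m - 1 - p`. -/
theorem linked_lowZone_of_high (hA : Admissible m n a w) {p q : ℤ} (h : OnBoard m n p q)
    (hi : 2 * (m + n - 2) - w ≤ 2 * (p + q)) (hi' : p + q ≤ m + n - 2 - a) :
    ∃ q', Linked m n a w p q (m - 1 - p) q' ∧ LowZone m n a w (m - 1 - p) q' := by
  have hA' := hA
  obtain ⟨h1, h2, h3, h4, h5, h6, h7⟩ := hA
  rcases lt_or_ge (p + (n - 1)) (m + n - 2 - a) with hc | hc
  · refine ⟨0, ?_, ?_⟩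
    · have e1 : Linked m n a w p q p (n - 1) := by
        apply linked_column' <;> simp only [OnBoard, NorthZone] at * <;> intros <;> omega
      refine e1.trans ?_
      apply linked_exit_north <;> simp only [OnBoard, NorthZone] at * <;> omega
    · unfold LowZone OnBoard at *
      omega
  · have e1 : Linked m n a w p q p (m + n - 2 - a - p) := by
      apply linked_column' <;> simp only [OnBoard, NorthZone] at * <;> intros <;> omega
    have e2 := linked_lowZone_of_upper hA' (p := p) (q := m + n - 2 - a - p)
      (by unfold OnBoard at *; omega) (by omega)
    rw [show a - ((n : ℤ) - 1 - (m + n - 2 - a - p)) = m - 1 - p by ring] at e2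
    exact ⟨_, e1.trans e2.1, e2.2⟩

theorem exists_linked_lowZone (hA : Admissible m n a w) {p q : ℤ} (h : OnBoard m n p q) :
    ∃ p' q', Linked m n a w p q p' q' ∧ LowZone m n a w p' q' := by
  have hA' := hA
  obtain ⟨h1, h2, h3, h4, h5, h6, h7⟩ := hA
  by_cases c1 : p + q ≤ a
  · exact ⟨_, _, linked_lowZone_of_le hA' h c1⟩
  by_cases c2 : 2 * (p + q) ≤ w
  · exact ⟨p, q, Linked.refl p q, h, by omega, c2⟩
  by_cases c3 : 2 * (m + n - 2) - w ≤ 2 * (p + q)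
  · by_cases c4 : p + q ≤ m + n - 2 - a
    · exact ⟨_, linked_lowZone_of_high hA' h c3 c4⟩
    · exact ⟨_, _, linked_lowZone_of_upper hA' h (by omega)⟩
  obtain ⟨b, rfl⟩ : 2 ∣ w := by omega
  by_cases c4 : q ≤ b
  · refine ⟨b - q, q, Linked.symm ?_, ?_⟩
    · apply linked_row' <;> simp only [OnBoard, NorthZone] at * <;> intros <;> omega
    · unfold LowZone OnBoard at *
      omega
  -- Row `q` is too high to meet the low zone, but it is entered from row `n - 1 - q`, which meets
  -- it because `n - 2 ≤ w`.
  · refine ⟨b - (n - 1 - q), n - 1 - q, Linked.symm ?_, ?_⟩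
    · have e1 : Linked m n a (2 * b) (b - (n - 1 - q)) (n - 1 - q) (m - 1) (n - 1 - q) := by
        apply linked_row' <;> simp only [OnBoard, NorthZone] at * <;> intros <;> omega
      have e2 : Linked m n a (2 * b) (m - 1) (n - 1 - q) 0 (n - 1 - (n - 1 - q)) := by
        apply linked_exit_east <;> simp only [OnBoard, NorthZone] at * <;> omega
      rw [sub_sub_cancel] at e2
      refine (e1.trans e2).trans ?_
      apply linked_row' <;> simp only [OnBoard, NorthZone] at * <;> intros <;> omega
    · unfold LowZone OnBoard at *
      omega

theorem linked_of_lowZone_column {p q q' : ℤ} (h : LowZone m n a w p q)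
    (h' : LowZone m n a w p q') : Linked m n a w p q p q' := by
  wlog hq : q ≤ q' generalizing q q'
  · exact (this h' h (by omega)).symm
  apply linked_column' <;> simp only [LowZone, OnBoard, NorthZone] at * <;> intros <;> omega

/-- From column `p` climb to antidiagonal `w / 2` and run east to the upper band; the column reached
there is `m - 1 - p'`, which leads back to column `p'`. -/
theorem linked_of_lowZone_reflect (hA : Admissible m n a w) {p q p' q' : ℤ}
    (h : LowZone m n a w p q) (h' : LowZone m n a w p' q') (hp : p + p' = w - n + 1) :
    Linked m n a w p q p' q' := by
  have hA' := hA
  obtain ⟨h1, h2, h3, h4, h5, h6, h7⟩ := hA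
  wlog hle : p ≤ p' generalizing p q p' q'
  · exact (this h' h (by omega) (by omega)).symm
  have key : ∃ q₁ q₂, LowZone m n a w p q₁ ∧ Linked m n a w p q₁ (m - 1 - p') q₂ ∧
      OnBoard m n (m - 1 - p') q₂ ∧ 2 * (m + n - 2) - w ≤ 2 * (m - 1 - p' + q₂) ∧
      m - 1 - p' + q₂ ≤ m + n - 2 - a := by
    by_cases hw : 2 ∣ w
    · obtain ⟨b, rfl⟩ := hw
      refine ⟨b - p, b - p, ?_, ?_, ?_⟩
      · unfold LowZone OnBoard at *
        omega
      · apply linked_row' <;> simp only [LowZone, OnBoard, NorthZone] at * <;> intros <;> omega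
      · unfold LowZone OnBoard at *
        omega
    -- For odd `w` the two bands merge: no antidiagonal between them goes east, and column `p` is
    -- already `m - 1 - p'`.
    · obtain rfl : w = m + n - 2 := by omega
      obtain rfl : p = m - 1 - p' := by omega
      obtain ⟨b, hb⟩ : ∃ b : ℤ, (m : ℤ) + n - 2 = 2 * b + 1 := ⟨(m + n - 2) / 2, by omega⟩
      refine ⟨b - (m - 1 - p'), b - (m - 1 - p') + 1, ?_, ?_, ?_⟩
      · unfold LowZone OnBoard at *
        omega
      · apply linked_column' <;> simp only [LowZone, OnBoard, NorthZone] at * <;> intros <;> omega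
      · unfold LowZone OnBoard at *
        omega
  obtain ⟨q₁, q₂, k1, k2, k3, k4, k5⟩ := key
  obtain ⟨q₃, k6, k7⟩ := linked_lowZone_of_high hA' k3 k4 k5
  rw [sub_sub_cancel] at k6 k7
  exact (((linked_of_lowZone_column h k1).trans k2).trans k6).trans (linked_of_lowZone_column k7 h')

theorem Linked.cycleInvariant_eq (hA : Admissible m n a w) {p q p' q' : ℤ}
    (hb : OnBoard m n p q) (hb' : OnBoard m n p' q') (h : Linked m n a w p q p' q') :
    cycleInvariant m n a w p q = cycleInvariant m n a w p' q' := by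
  obtain ⟨i, hi⟩ := h.exists_nat_pow_eq
  have key : ∀ i : ℕ, ∀ v, cycleInvariant m n a w (((basePerm m n a w ^ i) v).1 : ℕ)
      (((basePerm m n a w ^ i) v).2 : ℕ) = cycleInvariant m n a w (v.1 : ℕ) (v.2 : ℕ) := by
    intro i
    induction i with
    | zero => intro v; rfl
    | succ i ih =>
      intro v
      rw [pow_succ', Equiv.Perm.mul_apply, cycleInvariant_apply hA, ih]
  have := key i (square m n p q)
  rw [hi, square_fst hb, square_snd hb, square_fst hb', square_snd hb'] at this
  exact this.symm

theorem exists_lowZone_cycleInvariant_eq (hA : Admissible m n a w) {p q : ℤ}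
    (h : OnBoard m n p q) : ∃ p' q', LowZone m n a w p' q' ∧ Linked m n a w p q p' q' ∧
      cycleInvariant m n a w p q = (2 * p' - (w - n + 1)).natAbs := by
  obtain ⟨p', q', h1, h2⟩ := exists_linked_lowZone hA h
  exact ⟨p', q', h2, h1, by rw [h1.cycleInvariant_eq hA h h2.1, cycleInvariant_lowZone h2]⟩

/-- Both cycles meet the low zone, and equal absolute values there mean equal or reflected columns.
-/
theorem linked_of_cycleInvariant_eq (hA : Admissible m n a w) {p q p' q' : ℤ}
    (hb : OnBoard m n p q) (hb' : OnBoard m n p' q')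
    (h : cycleInvariant m n a w p q = cycleInvariant m n a w p' q') :
    Linked m n a w p q p' q' := by
  obtain ⟨p₁, q₁, h1, h2, h3⟩ := exists_lowZone_cycleInvariant_eq hA hb
  obtain ⟨p₂, q₂, h4, h5, h6⟩ := exists_lowZone_cycleInvariant_eq hA hb'
  refine (h2.trans ?_).trans h5.symm
  by_cases hp : p₁ = p₂
  · subst hp
    exact linked_of_lowZone_column h1 h4
  · exact linked_of_lowZone_reflect hA h1 h4 (by omega)

/-- A run of squares on an antidiagonal, one from each cycle of the base permutation, yields a
hamiltonian path ending at its first square. -/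
theorem exists_path_of_run (hA : Admissible m n a w) (s : ℕ → ℤ × ℤ) (k : ℕ)
    (hb : ∀ j ≤ k, OnBoard m n (s j).1 (s j).2)
    (hlink : ∀ j < k, (projectiveCheckerboard m n).Adj (square m n (s (j + 1)).1 (s (j + 1)).2)
      (basePerm m n a w (square m n (s j).1 (s j).2)))
    (hdisj : ∀ i j, i < j → j ≤ k → cycleInvariant m n a w (s i).1 (s i).2 ≠
      cycleInvariant m n a w (s j).1 (s j).2)
    (hcover : ∀ p q, LowZone m n a w p q → ∃ j ≤ k, cycleInvariant m n a w (s j).1 (s j).2 =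
      (2 * p - (w - n + 1)).natAbs) :
    ∃ l, IsHamiltonianPath (projectiveCheckerboard m n) l ∧
      l.getLast? = some (square m n (s 0).1 (s 0).2) := by
  refine exists_isHamiltonianPath_of_cycles _ (basePerm m n a w) (adj_basePerm m n a w)
    (fun j => square m n (s j).1 (s j).2) k hlink ?_ ?_
  · intro i j hij hj h
    exact hdisj i j hij hj (Linked.cycleInvariant_eq hA (hb i (by omega)) (hb j hj) h)
  · intro v
    obtain ⟨p, q, h1, -, h3⟩ := exists_lowZone_cycleInvariant_eq hA (onBoard_coe v)
    obtain ⟨j, hj, hj'⟩ := hcover p q h1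
    refine ⟨j, hj, ?_⟩
    have := linked_of_cycleInvariant_eq hA (hb j hj) (onBoard_coe v) (by rw [hj', h3])
    unfold Linked at this
    rwa [square_coe] at this

/-- The base move of `(p, q)` and the north move of `(p + 1, q - 1)` enter the same square `(p + 1,
q)`. -/
theorem exists_path_of_north_links (hA : Admissible m n a w) {x y : ℤ} (k : ℕ)
    (hb : OnBoard m n x y) (hx : x + k < m) (hy : k ≤ y) (hz : ¬ NorthZone m n a w (x + y))
    (hdisj : ∀ i j : ℕ, i < j → j ≤ k → cycleInvariant m n a w (x + i) (y - i) ≠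
      cycleInvariant m n a w (x + j) (y - j))
    (hcover : ∀ p q, LowZone m n a w p q → ∃ j : ℕ, j ≤ k ∧
      cycleInvariant m n a w (x + j) (y - j) = (2 * p - (w - n + 1)).natAbs) :
    ∃ l, IsHamiltonianPath (projectiveCheckerboard m n) l ∧
      l.getLast? = some (square m n x y) := by
  have hb' : ∀ j : ℕ, j ≤ k → OnBoard m n (x + j) (y - j) := by
    intro j hj
    unfold OnBoard at *
    omega
  have := exists_path_of_run hA (fun j => (x + j, y - j)) k hb' ?_ hdisj hcover
  · simpa using this
  · intro j hj
    have h1 := hb' j (by omega)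
    have h2 := hb' (j + 1) (by omega)
    push_cast at h2 ⊢
    refine Or.inr ?_
    rw [basePerm_square_of_not h1 (by rwa [show x + j + (y - j) = x + y by ring]),
      moveEast_square h1 (by omega), moveNorth_square h2 (by unfold OnBoard at *; omega)]
    congr 1 <;> ring

theorem exists_path_of_east_links (hA : Admissible m n a w) {x y : ℤ} (k : ℕ)
    (hb : OnBoard m n x y) (hx : k ≤ x) (hy : y + k < n) (hz : NorthZone m n a w (x + y))
    (hdisj : ∀ i j : ℕ, i < j → j ≤ k → cycleInvariant m n a w (x - i) (y + i) ≠
      cycleInvariant m n a w (x - j) (y + j))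
    (hcover : ∀ p q, LowZone m n a w p q → ∃ j : ℕ, j ≤ k ∧
      cycleInvariant m n a w (x - j) (y + j) = (2 * p - (w - n + 1)).natAbs) :
    ∃ l, IsHamiltonianPath (projectiveCheckerboard m n) l ∧
      l.getLast? = some (square m n x y) := by
  have hb' : ∀ j : ℕ, j ≤ k → OnBoard m n (x - j) (y + j) := by
    intro j hj
    unfold OnBoard at *
    omega
  have := exists_path_of_run hA (fun j => (x - j, y + j)) k hb' ?_ hdisj hcover
  · simpa using this
  · intro j hj
    have h1 := hb' j (by omega)
    have h2 := hb' (j + 1) (by omega)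
    push_cast at h2 ⊢
    refine Or.inl ?_
    rw [basePerm_square h1 (by rwa [show x - j + (y + j) = x + y by ring]),
      moveNorth_square h1 (by omega), moveEast_square h2 (by unfold OnBoard at *; omega)]
    congr 1 <;> ring

end Engine

/-! ### Sufficiency: a band and a run for each region -/

section Existence

variable {m n : ℕ} [NeZero m] [NeZero n] {x y : ℤ}

/-- There is a hamiltonian path ending at the square `(x, y)`. -/
def IsTerminal (m n : ℕ) [NeZero m] [NeZero n] (x y : ℤ) : Prop :=
  ∃ l, IsHamiltonianPath (projectiveCheckerboard m n) l ∧ l.getLast? = some (square m n x y)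

/-- With `w = 2 * a` the band is empty and every base move goes east, so a cycle is a pair of rows
`q`, `n - 1 - q`. The run takes one row of each pair, from the top down to the middle. -/
theorem isTerminal_top (hn : 3 ≤ n) (hmn : n ≤ m) (hx : 0 ≤ x) (hx' : x ≤ m - (n + 1) / 2)
    (hy : y = n - 1) : IsTerminal m n x y := by
  refine exists_path_of_north_links (a := n - 1) (w := 2 * (n - 1)) ?_ ((n - 1) / 2)
    ?_ ?_ ?_ ?_ ?_ ?_
  · constructor <;> omega
  · simp only [OnBoard]; omega
  · omega
  · omega
  · simp only [NorthZone]; omega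
  · intro i j hij hj
    simp only [cycleInvariant]
    split_ifs <;> omega
  · intro p q hp
    simp only [LowZone, OnBoard] at hp
    by_cases h : p ≤ (n - 1) / 2
    · refine ⟨p.toNat, by omega, ?_⟩
      simp only [cycleInvariant]
      split_ifs <;> omega
    · refine ⟨(n - 1 - p).toNat, by omega, ?_⟩
      simp only [cycleInvariant]
      split_ifs <;> omega

/-- Again every base move goes east; the run takes the rows from the middle down to `0`. -/
theorem isTerminal_lower_middle (hn : 3 ≤ n) (hmn : n ≤ m) (hx : 0 ≤ x)
    (hx' : x ≤ m - (n + 1) / 2) (hy : y = (n - 1) / 2) : IsTerminal m n x y := by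
  refine exists_path_of_north_links (a := n - 1) (w := 2 * (n - 1)) ?_ ((n - 1) / 2)
    ?_ ?_ ?_ ?_ ?_ ?_
  · constructor <;> omega
  · simp only [OnBoard]; omega
  · omega
  · omega
  · simp only [NorthZone]; omega
  · intro i j hij hj
    simp only [cycleInvariant]
    split_ifs <;> omega
  · intro p q hp
    simp only [LowZone, OnBoard] at hp
    by_cases h : n - 1 - p ≤ (n - 1) / 2
    · refine ⟨(y - (n - 1 - p)).toNat, by omega, ?_⟩
      simp only [cycleInvariant]
      split_ifs <;> omega
    · refine ⟨(y - p).toNat, by omega, ?_⟩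
      simp only [cycleInvariant]
      split_ifs <;> omega

/-- Here the reflection is `p ↦ n - 1 - p`, and the run moves left from the right edge, representing
columns `0, …, (n - 1) / 2`. -/
theorem isTerminal_right (hn : 3 ≤ n) (hmn : n ≤ m) (hx : x = m - 1) (hy : 0 ≤ y)
    (hy' : y ≤ n / 2) : IsTerminal m n x y := by
  refine exists_path_of_east_links (a := 0) (w := 2 * (n - 1)) ?_ ((n - 1) / 2)
    ?_ ?_ ?_ ?_ ?_ ?_
  · constructor <;> omega
  · simp only [OnBoard]; omega
  · omega
  · omega
  · simp only [NorthZone]; omega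
  · intro i j hij hj
    simp only [cycleInvariant]
    split_ifs <;> omega
  · intro p q hp
    simp only [LowZone, OnBoard] at hp
    by_cases h : p ≤ (n - 1) / 2
    · refine ⟨p.toNat, by omega, ?_⟩
      simp only [cycleInvariant]
      split_ifs <;> omega
    · refine ⟨(n - 1 - p).toNat, by omega, ?_⟩
      simp only [cycleInvariant]
      split_ifs <;> omega

/-- The choice of `w` makes the antidiagonal of `(x, y)` the first of the upper band and puts `m - 1
- x` at, or half a step above, the centre of the reflection. -/
theorem isTerminal_upper_middle (hn : 3 ≤ n) (hmn : n ≤ m) (hx : m - n / 2 - 1 ≤ x)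
    (hx' : x ≤ m - 1) (hy : y = n / 2) : IsTerminal m n x y := by
  refine exists_path_of_east_links (a := 0) (w := 2 * (m - 1 - x + (n - 1) / 2)) ?_ ((n - 1) / 2)
    ?_ ?_ ?_ ?_ ?_ ?_
  · constructor <;> omega
  · simp only [OnBoard]; omega
  · omega
  · omega
  · simp only [NorthZone]; omega
  · intro i j hij hj
    simp only [cycleInvariant]
    split_ifs <;> omega
  · intro p q hp
    simp only [LowZone, OnBoard] at hp
    by_cases h : m - 1 - x ≤ p
    · refine ⟨(p - (m - 1 - x)).toNat, by omega, ?_⟩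
      simp only [cycleInvariant]
      split_ifs <;> omega
    · refine ⟨(2 * (m - 1 - x + (n - 1) / 2) - n + 1 - p - (m - 1 - x)).toNat, by omega, ?_⟩
      simp only [cycleInvariant]
      split_ifs <;> omega

/-- The band starts at the antidiagonal of `(x, y)`, and `w` puts `x` at, or half a step below, the
centre of the reflection. The cap `m + n - 2` is active only for `m` odd, `n` even, `x = (m - 1) /
2`; this is where an odd `w` occurs. -/
theorem isTerminal_lower_block (hn : 3 ≤ n) (hmn : n ≤ m) (hx : (n - 1) / 2 ≤ x)
    (hx' : x ≤ (m - 1) / 2) (hy : 0 ≤ y) (hy' : y < (n - 1) / 2) : IsTerminal m n x y := by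
  refine exists_path_of_east_links (a := x + y) (w := min (2 * (x + n / 2)) (m + n - 2)) ?_
    (min x (n - 1 - y)).toNat ?_ ?_ ?_ ?_ ?_ ?_
  · constructor <;> omega
  · simp only [OnBoard]; omega
  · omega
  · omega
  · simp only [NorthZone]; omega
  · intro i j hij hj
    simp only [cycleInvariant]
    split_ifs <;> omega
  · intro p q hp
    simp only [LowZone, OnBoard] at hp
    by_cases h : p ≤ x
    · refine ⟨(x - p).toNat, by omega, ?_⟩
      simp only [cycleInvariant]
      split_ifs <;> omega
    · refine ⟨(x - (min (2 * (x + n / 2)) (m + n - 2) - n + 1 - p)).toNat, by omega, ?_⟩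
      simp only [cycleInvariant]
      split_ifs <;> omega

/-- Half-turn counterpart of the lower block: the antidiagonal of `(x, y)` is the first one past the
upper band, so its base moves go east. -/
theorem isTerminal_upper_block (hn : 3 ≤ n) (hmn : n ≤ m) (hx : m / 2 ≤ x)
    (hx' : x ≤ m - (n + 1) / 2) (hy : (n - 1) / 2 < y) (hy' : y ≤ n - 1) : IsTerminal m n x y := by
  refine exists_path_of_north_links (a := m + n - 2 - x - y)
    (w := min (2 * (m - 1 - x + n / 2)) (m + n - 2)) ?_
    (min (m - 1 - x) y).toNat ?_ ?_ ?_ ?_ ?_ ?_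
  · constructor <;> omega
  · simp only [OnBoard]; omega
  · omega
  · omega
  · simp only [NorthZone]; omega
  · intro i j hij hj
    simp only [cycleInvariant]
    split_ifs <;> omega
  · intro p q hp
    simp only [LowZone, OnBoard] at hp
    by_cases h : p ≤ m - 1 - x
    · refine ⟨(m - 1 - x - p).toNat, by omega, ?_⟩
      simp only [cycleInvariant]
      split_ifs <;> omega
    · refine ⟨(m - 1 - x - (min (2 * (m - 1 - x + n / 2)) (m + n - 2) - n + 1 - p)).toNat,
        by omega, ?_⟩
      simp only [cycleInvariant]
      split_ifs <;> omega

end Existence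

/-! ### Necessity: a path as a ranking of the squares -/

/-- A hamiltonian path ending at `(x, y)`, described by the position `rank p q` of each square in
the path and by the squares from which the path travels east. -/
structure Ranking (m n : ℕ) (x y : ℤ) where
  rank : ℤ → ℤ → ℕ
  east : ℤ → ℤ → Prop
  inj : ∀ {p q p' q'}, OnBoard m n p q → OnBoard m n p' q' → rank p q = rank p' q' →
    p = p' ∧ q = q'
  east_step : ∀ {p q}, OnBoard m n p q → ¬ (p = x ∧ q = y) → east p q → p + 1 < m →
    rank (p + 1) q = rank p q + 1
  east_exit : ∀ {p q}, OnBoard m n p q → ¬ (p = x ∧ q = y) → east p q → p = m - 1 →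
    rank 0 (n - 1 - q) = rank p q + 1
  north_step : ∀ {p q}, OnBoard m n p q → ¬ (p = x ∧ q = y) → ¬ east p q → q + 1 < n →
    rank p (q + 1) = rank p q + 1
  north_exit : ∀ {p q}, OnBoard m n p q → ¬ (p = x ∧ q = y) → ¬ east p q → q = n - 1 →
    rank (m - 1 - p) 0 = rank p q + 1

theorem exists_idxOf_succ {V : Type*} [BEq V] [LawfulBEq V] {G : Digraph V} {l : List V}
    (hl : IsHamiltonianPath G l) {t v : V} (ht : l.getLast? = some t) (hv : v ≠ t) :
    ∃ u, G.Adj v u ∧ l.idxOf u = l.idxOf v + 1 := by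
  obtain ⟨h1, h2, h3⟩ := hl
  have hi : l.idxOf v < l.length := List.idxOf_lt_length_of_mem (h3 v)
  have hi' : l.idxOf v + 1 < l.length := by
    by_contra hcon
    have : l.length - 1 = l.idxOf v := by omega
    rw [List.getLast?_eq_getElem?, this, List.getElem?_eq_getElem hi, List.getElem_idxOf] at ht
    exact hv (Option.some.inj ht)
  refine ⟨l[l.idxOf v + 1], ?_, h2.idxOf_getElem _ _⟩
  have := List.isChain_iff_getElem.1 h1 (l.idxOf v) hi'
  rwa [List.getElem_idxOf] at this

theorem nonempty_ranking {m n : ℕ} [NeZero m] [NeZero n] {x y : ℤ} (hb : OnBoard m n x y)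
    (h : IsTerminal m n x y) : Nonempty (Ranking m n x y) := by
  obtain ⟨l, hl, ht⟩ := h
  have key : ∀ {p q}, OnBoard m n p q → ¬ (p = x ∧ q = y) → ∃ u,
      (projectiveCheckerboard m n).Adj (square m n p q) u ∧
        l.idxOf u = l.idxOf (square m n p q) + 1 :=
    fun hpq hne => exists_idxOf_succ hl ht fun he => hne (square_inj hpq hb he)
  refine ⟨⟨fun p q => l.idxOf (square m n p q), fun p q =>
    l.idxOf (moveEast (square m n p q)) = l.idxOf (square m n p q) + 1, ?_, ?_, ?_, ?_, ?_⟩⟩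
  · intro p q p' q' h1 h2 h3
    exact square_inj h1 h2 ((List.idxOf_inj (hl.2.2 _)).1 h3)
  · intro p q h1 _ h3 h4
    rwa [moveEast_square h1 h4] at h3
  · rintro p q h1 _ h3 rfl
    rwa [moveEast_square_last h1] at h3
  · intro p q h1 h2 h3 h4
    obtain ⟨u, rfl | rfl, hu⟩ := key h1 h2
    · exact absurd hu h3
    · rwa [moveNorth_square h1 h4] at hu
  · rintro p q h1 h2 h3 rfl
    obtain ⟨u, rfl | rfl, hu⟩ := key h1 h2
    · exact absurd hu h3
    · rwa [moveNorth_square_last h1] at hu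

/-! ### Acyclicity constraints along the rails -/

section Rails

/-- Travelling east is inherited down a rail, so the directions on a stretch free of the terminal
square are given by one cut. -/
theorem exists_threshold {P : ℤ → Prop} {l h : ℤ} (hlh : l ≤ h + 1)
    (hP : ∀ q, l ≤ q → q < h → P q → P (q + 1)) :
    ∃ w, l ≤ w ∧ w ≤ h + 1 ∧ ∀ q, l ≤ q → q ≤ h → (P q ↔ w ≤ q) := by
  obtain ⟨k, rfl⟩ : ∃ k : ℕ, h = l + k - 1 := ⟨(h + 1 - l).toNat, by omega⟩
  induction k with
  | zero => exact ⟨l, le_rfl, by omega, fun q _ _ => by omega⟩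
  | succ k ih =>
    push_cast at *
    obtain ⟨w, h1, h2, h3⟩ := ih (by omega) fun q hq hq' => hP q hq (by omega)
    by_cases hk : P (l + k)
    · refine ⟨w, h1, by omega, fun q hq hq' => ?_⟩
      rcases lt_or_eq_of_le (show q ≤ l + k by omega) with hlt | rfl
      · exact h3 q hq (by omega)
      · exact ⟨fun _ => by omega, fun _ => hk⟩
    · refine ⟨l + k + 1, by omega, by omega, fun q hq hq' => ⟨fun hPq => ?_, fun _ => by omega⟩⟩
      rcases lt_or_eq_of_le (show q ≤ l + k by omega) with hlt | rfl
      · exfalso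
        have hw := (h3 q hq (by omega)).1 hPq
        have := hP (l + k - 1) (by omega) (by omega) ((h3 _ (by omega) (by omega)).2 (by omega))
        rw [sub_add_cancel] at this
        exact hk this
      · exact absurd hPq hk

theorem exists_threshold' {P : ℤ → Prop} {l h : ℤ} (hlh : l ≤ h + 1)
    (hP : ∀ q, l < q → q ≤ h → P q → P (q - 1)) :
    ∃ w, l ≤ w ∧ w ≤ h + 1 ∧ ∀ q, l ≤ q → q ≤ h → (P q ↔ q < w) := by
  obtain ⟨w, h1, h2, h3⟩ := exists_threshold (P := fun q => ¬ P q) hlh (by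
    intro q hq hq' hn hp
    have := hP (q + 1) (by omega) (by omega) hp
    rw [add_sub_cancel_right] at this
    exact hn this)
  refine ⟨w, h1, h2, fun q hq hq' => ?_⟩
  have := h3 q hq hq'
  rw [← not_le, ← this, not_not]

/-- Each `α q` precedes the mirror image `B (t - q)` when it exists, and `B q` otherwise. -/
def Mirrored (c t : ℤ) (α B : ℤ → ℕ) : Prop :=
  ∀ q, 0 ≤ q → q ≤ c → (0 ≤ t - q ∧ t - q ≤ c → α q ≤ B (t - q)) ∧
    (¬ (0 ≤ t - q ∧ t - q ≤ c) → α q ≤ B q)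

/-- The index `y` is the only one with no return from `B`. Two unshifted returns at indices of sum
`t`, or two returns shifted by -1 at indices of sum `t + 1`, would close a cycle with `hM`, as would
an unshifted return whose mirror index is out of range. -/
theorem Mirrored.star_eq_of_minus {c t y v : ℤ} {α B : ℤ → ℕ} (hM : Mirrored c t α B)
    (ht : -1 ≤ t) (hy : 0 ≤ y) (hyv : y ≤ v) (hv : v ≤ c)
    (h1 : ∀ q, 0 ≤ q → q < y → B q < α q) (h2 : ∀ q, y < q → q ≤ v → B q < α (q - 1))
    (h3 : ∀ q, v < q → q ≤ c → B q < α q) :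
    (t ≤ c ∧ (2 * y = t ∨ 2 * y = t + 1)) ∨ (c ≤ t ∧ y = 0) := by
  have C1 : ∀ q q', 0 ≤ q → q ≤ c → 0 ≤ q' → q' ≤ c → q + q' = t → B q < α q → B q' < α q' →
      False := by
    intro q q' a1 a2 a3 a4 a5 a6 a7
    have b1 := (hM q a1 a2).1 (by omega)
    have b2 := (hM q' a3 a4).1 (by omega)
    rw [show t - q = q' by omega] at b1
    rw [show t - q' = q by omega] at b2
    omega
  have C2 : ∀ q, 0 ≤ q → q ≤ c → ¬ (0 ≤ t - q ∧ t - q ≤ c) → B q < α q → False := by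
    intro q a1 a2 a3 a4
    have := (hM q a1 a2).2 a3
    omega
  have C3 : ∀ q q', 1 ≤ q → q ≤ c → 1 ≤ q' → q' ≤ c → q + q' = t + 1 → B q < α (q - 1) →
      B q' < α (q' - 1) → False := by
    intro q q' a1 a2 a3 a4 a5 a6 a7
    have b1 := (hM (q - 1) (by omega) (by omega)).1 (by omega)
    have b2 := (hM (q' - 1) (by omega) (by omega)).1 (by omega)
    rw [show t - (q - 1) = q' by omega] at b1
    rw [show t - (q' - 1) = q by omega] at b2
    omega
  rcases le_or_gt t c with htc | htc
  · rcases lt_trichotomy (2 * y) t with hlt | heq | hgt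
    · have hz : t / 2 + t / 2 = t → ¬ v < t / 2 := fun he hlt' =>
        C1 (t / 2) (t / 2) (by omega) (by omega) (by omega) (by omega) he
          (h3 _ hlt' (by omega)) (h3 _ hlt' (by omega))
      have hvt : v ≤ t / 2 := by
        by_contra hcon
        exact C3 (t / 2 + 1) ((t + 1) / 2) (by omega) (by omega) (by omega) (by omega) (by omega)
          (h2 _ (by omega) (by omega)) (h2 _ (by omega) (by omega))
      have hy0 : y = 0 := by
        by_contra hcon
        exact C1 0 t (by omega) (by omega) (by omega) (by omega) (by omega)
          (h1 0 (by omega) (by omega)) (h3 t (by omega) (by omega))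
      refine Or.inr ⟨?_, hy0⟩
      by_contra hcon
      exact C2 c (by omega) (by omega) (by omega) (h3 c (by omega) (by omega))
    · exact Or.inl ⟨htc, Or.inl heq⟩
    · by_cases he : 2 * y = t + 1
      · exact Or.inl ⟨htc, Or.inr he⟩
      exfalso
      by_cases ht' : t = -1
      · exact C2 0 (by omega) (by omega) (by omega) (h1 0 (by omega) (by omega))
      · exact C1 (t / 2) (t - t / 2) (by omega) (by omega) (by omega) (by omega) (by omega)
          (h1 _ (by omega) (by omega)) (h1 _ (by omega) (by omega))
  · refine Or.inr ⟨htc.le, ?_⟩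
    by_contra hcon
    exact C2 0 (by omega) (by omega) (by omega) (h1 0 (by omega) (by omega))

/-- Reversing the index by `q ↦ c - q` turns shift 1 into shift -1 and `t` into `2 * c - t`. -/
theorem Mirrored.star_eq_of_plus {c t u y : ℤ} {α B : ℤ → ℕ} (hM : Mirrored c t α B)
    (ht : t ≤ 2 * c + 1) (hu : 0 ≤ u) (huy : u ≤ y) (hy : y ≤ c)
    (h1 : ∀ q, 0 ≤ q → q < u → B q < α q) (h2 : ∀ q, u ≤ q → q < y → B q < α (q + 1))
    (h3 : ∀ q, y < q → q ≤ c → B q < α q) :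
    (c ≤ t ∧ (2 * y = t ∨ 2 * y = t - 1)) ∨ (t ≤ c ∧ y = c) := by
  have hM' : Mirrored c (2 * c - t) (fun q => α (c - q)) (fun q => B (c - q)) := by
    intro q hq hq'
    have := hM (c - q) (by omega) (by omega)
    beta_reduce
    rw [show c - (2 * c - t - q) = t - (c - q) by ring]
    exact ⟨fun h => this.1 (by omega), fun h => this.2 (by omega)⟩
  have := hM'.star_eq_of_minus (y := c - y) (v := c - u) (by omega) (by omega) (by omega)
    (by omega) (fun q _ _ => h3 _ (by omega) (by omega))
    (fun q _ _ => by
      have := h2 (c - q) (by omega) (by omega)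
      rwa [show c - q + 1 = c - (q - 1) by ring] at this)
    (fun q _ _ => h1 _ (by omega) (by omega))
  omega

/-- `eA` and `eB` are the east squares of the lower and upper rail. The letters `z`, `p`, `m` mean a
return with shift 0, 1, -1, and `E`, `N` the move made on the upper rail. The cuts on the rails and
the links between their ends leave only shift patterns covered by the two `star_eq` lemmas. -/
theorem Mirrored.terminal_on_upper {c t y : ℤ} {α B : ℤ → ℕ} {eA eB : ℤ → Prop}
    (hM : Mirrored c t α B) (ht : -1 ≤ t) (ht' : t ≤ 2 * c + 1) (hc : 1 ≤ c) (hy : 0 ≤ y)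
    (hyc : y ≤ c)
    (zE : ∀ q, 0 ≤ q → q ≤ c → q ≠ y → eB q → (q < c → eA q) → B q < α q)
    (pE : ∀ q, 0 ≤ q → q < c → q ≠ y → eB q → ¬ eA q → B q < α (q + 1))
    (zN : ∀ q, 0 ≤ q → q ≤ c → q ≠ y → ¬ eB q → (0 < q → ¬ eA (q - 1)) → B q < α q)
    (mN : ∀ q, 0 < q → q ≤ c → q ≠ y → ¬ eB q → eA (q - 1) → B q < α (q - 1))
    (hA : ∀ q, 0 < q → q < c → eA q → eA (q - 1)) (hAB : y ≠ 0 → eA 0 → eB 0)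
    (hB : ∀ q, 0 ≤ q → q < c → q ≠ y → q + 1 ≠ y → eB q → eB (q + 1))
    (hBA : y ≠ c → eB c → eA (c - 1)) :
    ((t ≤ c ∧ (2 * y = t ∨ 2 * y = t + 1)) ∨ (c ≤ t ∧ y = 0)) ∨
      (¬ eA (c - 1) ∧ ((c ≤ t ∧ (2 * y = t ∨ 2 * y = t - 1)) ∨ (t ≤ c ∧ y = c))) := by
  obtain ⟨v, v1, v2, v3⟩ := exists_threshold (P := eB) (l := y + 1) (h := c) (by omega)
    fun q _ _ => hB q (by omega) (by omega) (by omega) (by omega)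
  obtain ⟨u, u1, u2, u3⟩ := exists_threshold (P := eB) (l := 0) (h := y - 1) (by omega)
    fun q _ _ => hB q (by omega) (by omega) (by omega) (by omega)
  obtain ⟨w, w1, w2, w3⟩ := exists_threshold' (P := eA) (l := 0) (h := c - 1) (by omega)
    fun q _ _ => hA q (by omega) (by omega)
  have hu : 0 < w → y ≠ 0 → u = 0 := fun h h' => by
    have := (u3 0 le_rfl (by omega)).1 (hAB h' ((w3 0 le_rfl (by omega)).2 h))
    omega
  by_cases hv : v ≤ c
  · have hw : w = c := by
      have := (w3 (c - 1) (by omega) (by omega)).1 (hBA (by omega) ((v3 c (by omega) le_rfl).2 hv))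
      omega
    refine Or.inl (hM.star_eq_of_minus (v := v - 1) ht hy (by omega) (by omega) ?_ ?_ ?_)
    · intro q _ _
      exact zE q (by omega) (by omega) (by omega) ((u3 q (by omega) (by omega)).2 (by omega))
        fun _ => (w3 q (by omega) (by omega)).2 (by omega)
    · intro q _ _
      exact mN q (by omega) (by omega) (by omega)
        (fun h => by have := (v3 q (by omega) (by omega)).1 h; omega)
        ((w3 (q - 1) (by omega) (by omega)).2 (by omega))
    · intro q _ _
      exact zE q (by omega) (by omega) (by omega) ((v3 q (by omega) (by omega)).2 (by omega))
        fun _ => (w3 q (by omega) (by omega)).2 (by omega)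
  have hBN : ∀ q, y < q → q ≤ c → ¬ eB q := fun q _ _ h => by
    have := (v3 q (by omega) (by omega)).1 h
    omega
  by_cases hw : y ≤ w
  · refine Or.inl (hM.star_eq_of_minus (v := w) ht hy (by omega) (by omega) ?_ ?_ ?_)
    · intro q _ _
      exact zE q (by omega) (by omega) (by omega)
        ((u3 q (by omega) (by omega)).2 (by have := hu (by omega) (by omega); omega))
        fun _ => (w3 q (by omega) (by omega)).2 (by omega)
    · intro q _ _
      exact mN q (by omega) (by omega) (by omega) (hBN q (by omega) (by omega))
        ((w3 (q - 1) (by omega) (by omega)).2 (by omega))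
    · intro q _ _
      exact zN q (by omega) (by omega) (by omega) (hBN q (by omega) (by omega))
        fun _ h => by have := (w3 (q - 1) (by omega) (by omega)).1 h; omega
  · refine Or.inr ⟨fun h => by have := (w3 (c - 1) (by omega) (by omega)).1 h; omega, ?_⟩
    have hAN : ∀ q, w ≤ q → q < c → ¬ eA q := fun q _ _ h => by
      have := (w3 q (by omega) (by omega)).1 h
      omega
    by_cases hw0 : 0 < w
    · have hu0 := hu hw0 (by omega)
      refine hM.star_eq_of_plus (u := w) ht' (by omega) (by omega) hyc ?_ ?_ ?_
      · intro q _ _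
        exact zE q (by omega) (by omega) (by omega) ((u3 q (by omega) (by omega)).2 (by omega))
          fun _ => (w3 q (by omega) (by omega)).2 (by omega)
      · intro q _ _
        exact pE q (by omega) (by omega) (by omega) ((u3 q (by omega) (by omega)).2 (by omega))
          (hAN q (by omega) (by omega))
      · intro q _ _
        exact zN q (by omega) (by omega) (by omega) (hBN q (by omega) (by omega))
          fun _ => hAN (q - 1) (by omega) (by omega)
    · refine hM.star_eq_of_plus (u := u) ht' (by omega) (by omega) hyc ?_ ?_ ?_
      · intro q _ _
        exact zN q (by omega) (by omega) (by omega)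
          (fun h => by have := (u3 q (by omega) (by omega)).1 h; omega)
          fun _ => hAN (q - 1) (by omega) (by omega)
      · intro q _ _
        exact pE q (by omega) (by omega) (by omega) ((u3 q (by omega) (by omega)).2 (by omega))
          (hAN q (by omega) (by omega))
      · intro q _ _
        exact zN q (by omega) (by omega) (by omega) (hBN q (by omega) (by omega))
          fun _ => hAN (q - 1) (by omega) (by omega)

/-- A return through the lower square `y` comes from the upper square `y` by an east move or from `y
+ 1` by a north move, so the index without a return is `y` or `y + 1`, according to the cut on the
upper rail. -/
theorem Mirrored.terminal_on_lower {c t y : ℤ} {α B : ℤ → ℕ} {eA eB : ℤ → Prop}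
    (hM : Mirrored c t α B) (ht : -1 ≤ t) (ht' : t ≤ 2 * c + 1) (hy : 0 ≤ y) (hyc : y < c)
    (zE : ∀ q, 0 ≤ q → q ≤ c → q ≠ y → eB q → (q < c → eA q) → B q < α q)
    (pE : ∀ q, 0 ≤ q → q < c → q ≠ y → eB q → ¬ eA q → B q < α (q + 1))
    (zN : ∀ q, 0 ≤ q → q ≤ c → q ≠ y + 1 → ¬ eB q → (0 < q → ¬ eA (q - 1)) → B q < α q)
    (mN : ∀ q, 0 < q → q ≤ c → q ≠ y + 1 → ¬ eB q → eA (q - 1) → B q < α (q - 1))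
    (hA : ∀ q, 0 < q → q < c → q ≠ y → q - 1 ≠ y → eA q → eA (q - 1))
    (hAB : y ≠ 0 → eA 0 → eB 0) (hB : ∀ q, 0 ≤ q → q < c → eB q → eB (q + 1))
    (hBA : y ≠ c - 1 → eB c → eA (c - 1)) :
    (t ≤ c ∧ (2 * (y + 1) = t ∨ 2 * (y + 1) = t + 1)) ∨
      (c ≤ t ∧ (2 * y = t ∨ 2 * y = t - 1)) := by
  obtain ⟨w, w1, w2, w3⟩ := exists_threshold (P := eB) (l := 0) (h := c) (by omega)
    fun q _ _ => hB q (by omega) (by omega)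
  obtain ⟨u, u1, u2, u3⟩ := exists_threshold' (P := eA) (l := 0) (h := y - 1) (by omega)
    fun q _ _ => hA q (by omega) (by omega) (by omega) (by omega)
  obtain ⟨v, v1, v2, v3⟩ := exists_threshold' (P := eA) (l := y + 1) (h := c - 1) (by omega)
    fun q _ _ => hA q (by omega) (by omega) (by omega) (by omega)
  have hu : 0 < w → u = 0 := fun h => by
    by_contra hcon
    have := (w3 0 le_rfl (by omega)).1 (hAB (by omega) ((u3 0 le_rfl (by omega)).2 (by omega)))
    omega
  have hv : w ≤ c → v = c := fun h => by
    by_cases hyc' : y = c - 1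
    · omega
    have := (v3 (c - 1) (by omega) (by omega)).1 (hBA hyc' ((w3 c (by omega) le_rfl).2 h))
    omega
  have hBE : ∀ q, w ≤ q → q ≤ c → eB q := fun q _ _ => (w3 q (by omega) (by omega)).2 (by omega)
  have hBN : ∀ q, 0 ≤ q → q < w → q ≤ c → ¬ eB q := fun q _ _ _ h => by
    have := (w3 q (by omega) (by omega)).1 h
    omega
  have hAN : ∀ q, u ≤ q → q < y → ¬ eA q := fun q _ _ h => by
    have := (u3 q (by omega) (by omega)).1 h
    omega
  have hAE : ∀ q, y < q → q < v → eA q := fun q _ _ => (v3 q (by omega) (by omega)).2 (by omega)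
  by_cases hwy : w ≤ y
  · have hvc := hv (by omega)
    suffices hs : (c ≤ t ∧ (2 * y = t ∨ 2 * y = t - 1)) ∨ (t ≤ c ∧ y = c) by omega
    refine hM.star_eq_of_plus (u := max u w) ht' (by omega) (by omega) hyc.le ?_ ?_ ?_
    · intro q _ _
      by_cases hw0 : 0 < w
      · have := hu hw0
        exact zN q (by omega) (by omega) (by omega) (hBN q (by omega) (by omega) (by omega))
          fun _ => hAN (q - 1) (by omega) (by omega)
      · exact zE q (by omega) (by omega) (by omega) (hBE q (by omega) (by omega))
          fun _ => (u3 q (by omega) (by omega)).2 (by omega)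
    · intro q _ _
      exact pE q (by omega) (by omega) (by omega) (hBE q (by omega) (by omega))
        (hAN q (by omega) (by omega))
    · intro q _ _
      exact zE q (by omega) (by omega) (by omega) (hBE q (by omega) (by omega))
        fun _ => hAE q (by omega) (by omega)
  · have hu0 := hu (by omega)
    suffices hs : (t ≤ c ∧ (2 * (y + 1) = t ∨ 2 * (y + 1) = t + 1)) ∨ (c ≤ t ∧ y + 1 = 0) by omega
    refine hM.star_eq_of_minus (v := max (y + 1) (min v (w - 1))) ht (by omega) (by omega)
      (by omega) ?_ ?_ ?_
    · intro q _ _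
      exact zN q (by omega) (by omega) (by omega) (hBN q (by omega) (by omega) (by omega))
        fun _ => hAN (q - 1) (by omega) (by omega)
    · intro q _ _
      exact mN q (by omega) (by omega) (by omega) (hBN q (by omega) (by omega) (by omega))
        (hAE (q - 1) (by omega) (by omega))
    · intro q _ _
      by_cases hqw : w ≤ q
      · have := hv (by omega)
        exact zE q (by omega) (by omega) (by omega) (hBE q (by omega) (by omega))
          fun _ => hAE q (by omega) (by omega)
      · exact zN q (by omega) (by omega) (by omega) (hBN q (by omega) (by omega) (by omega))
          fun _ h => by have := (v3 (q - 1) (by omega) (by omega)).1 h; omega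

/-- Returns now lead from the rail to itself: east moves pair indices of sum `n - 1`, north moves
those of sum `n - 2`, and both members of a pair cannot use the same return. -/
theorem terminal_on_single_rail {n y : ℤ} {A : ℤ → ℕ} {eA : ℤ → Prop} (hy : 0 ≤ y) (hyn : y < n)
    (hE : ∀ q, 0 ≤ q → q < n → q ≠ y → eA q → A q < A (n - 1 - q))
    (hN : ∀ q, 0 ≤ q → q < n - 1 → q ≠ y → ¬ eA q → A q < A (n - 2 - q))
    (hlast : n - 1 ≠ y → eA (n - 1))
    (hA : ∀ q, 0 < q → q < n → q ≠ y → q - 1 ≠ y → eA q → eA (q - 1)) :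
    y = n - 1 ∨ 2 * y = n - 1 ∨ 2 * y = n - 2 := by
  by_cases hyn' : y = n - 1
  · exact Or.inl hyn'
  obtain ⟨u, u1, u2, u3⟩ := exists_threshold' (P := eA) (l := 0) (h := y - 1) (by omega)
    fun q _ _ => hA q (by omega) (by omega) (by omega) (by omega)
  obtain ⟨v, v1, v2, v3⟩ := exists_threshold' (P := eA) (l := y + 1) (h := n - 1) (by omega)
    fun q _ _ => hA q (by omega) (by omega) (by omega) (by omega)
  have hv := (v3 (n - 1) (by omega) (by omega)).1 (hlast (by omega))
  have hEE : ∀ q q', 0 ≤ q → 0 ≤ q' → q + q' = n - 1 → q ≠ y → q' ≠ y → eA q → eA q' → False := by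
    intro q q' _ _ _ h1 h2 h3 h4
    have e1 := hE q (by omega) (by omega) h1 h3
    have e2 := hE q' (by omega) (by omega) h2 h4
    rw [show n - 1 - q = q' by omega] at e1
    rw [show n - 1 - q' = q by omega] at e2
    omega
  have hNN : ∀ q q', 0 ≤ q → 0 ≤ q' → q + q' = n - 2 → q ≠ y → q' ≠ y → ¬ eA q → ¬ eA q' →
      False := by
    intro q q' _ _ _ h1 h2 h3 h4
    have e1 := hN q (by omega) (by omega) h1 h3
    have e2 := hN q' (by omega) (by omega) h2 h4
    rw [show n - 2 - q = q' by omega] at e1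
    rw [show n - 2 - q' = q by omega] at e2
    omega
  have hu : u = 0 := by
    by_contra hcon
    exact hEE 0 (n - 1) le_rfl (by omega) (by omega) (by omega) (by omega)
      ((u3 0 le_rfl (by omega)).2 (by omega)) (hlast (by omega))
  have hAN : ∀ q, 0 ≤ q → q < y → ¬ eA q := fun q _ _ h => by
    have := (u3 q (by omega) (by omega)).1 h
    omega
  have h1 : 2 * y < n := by
    by_contra hcon
    exact hNN (y - 1) (n - 1 - y) (by omega) (by omega) (by omega) (by omega) (by omega)
      (hAN _ (by omega) (by omega)) (hAN _ (by omega) (by omega))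
  have h2 : n - 3 < 2 * y := by
    by_contra hcon
    exact hEE (y + 1) (n - 2 - y) (by omega) (by omega) (by omega) (by omega) (by omega)
      ((v3 _ (by omega) (by omega)).2 (by omega)) ((v3 _ (by omega) (by omega)).2 (by omega))
  omega

end Rails

/-! ### Common directions on paired antidiagonals, and tracing the path -/

section Directions

variable {m n : ℕ} {x y : ℤ}

/-- The antidiagonal `p + q = i` and the one paired with it avoid the terminal square. -/
def Free (m n : ℕ) (x y i : ℤ) : Prop := i ≠ x + y ∧ i ≠ m + n - 3 - (x + y)

namespace Ranking

/-- Otherwise both squares would enter `(p + 1, q)`. -/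
theorem east_down (P : Ranking m n x y) {p q : ℤ} (h : OnBoard m n p q)
    (h' : OnBoard m n (p + 1) (q - 1)) (t : ¬ (p = x ∧ q = y)) (t' : ¬ (p + 1 = x ∧ q - 1 = y))
    (he : P.east p q) : P.east (p + 1) (q - 1) := by
  by_contra hn
  simp only [OnBoard] at h h'
  have e1 := P.east_step h t he (by omega)
  have e2 := P.north_step h' t' hn (by omega)
  rw [sub_add_cancel] at e2
  have := P.inj h h' (by omega)
  omega

theorem east_cross_bottom (P : Ranking m n x y) {p : ℤ} (h : OnBoard m n p 0) (hp : p + 1 < m)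
    (t : ¬ (p = x ∧ 0 = y)) (t' : ¬ (m - 2 - p = x ∧ n - 1 = y)) (he : P.east p 0) :
    P.east (m - 2 - p) (n - 1) := by
  by_contra hn
  have h' : OnBoard m n (m - 2 - p) (n - 1) := by simp only [OnBoard] at *; omega
  have e1 := P.east_step h t he hp
  have e2 := P.north_exit h' t' hn rfl
  rw [show (m : ℤ) - 1 - (m - 2 - p) = p + 1 by ring] at e2
  have hi := P.inj h h' (by omega)
  by_cases hn1 : (n : ℤ) = 1
  · rw [show (n : ℤ) - 1 = 0 by omega, ← hi.1] at hn
    exact hn he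
  · omega

theorem east_cross_right (P : Ranking m n x y) {q : ℤ} (h : OnBoard m n (m - 1) q) (hq : q + 1 < n)
    (t : ¬ ((m : ℤ) - 1 = x ∧ q = y)) (t' : ¬ (0 = x ∧ n - 2 - q = y)) (he : P.east (m - 1) q) :
    P.east 0 (n - 2 - q) := by
  by_contra hn
  have h' : OnBoard m n 0 (n - 2 - q) := by simp only [OnBoard] at *; omega
  have e1 := P.east_exit h t he rfl
  have e2 := P.north_step h' t' hn (by simp only [OnBoard] at *; omega)
  rw [show (n : ℤ) - 2 - q + 1 = n - 1 - q by ring] at e2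
  have hi := P.inj h h' (by omega)
  rw [← hi.2, ← hi.1] at hn
  exact hn he

theorem east_along (P : Ranking m n x y) {p q : ℤ} (k : ℕ) (h : OnBoard m n p q)
    (h' : OnBoard m n (p + k) (q - k)) (hi : p + q ≠ x + y) (he : P.east p q) :
    P.east (p + k) (q - k) := by
  induction k with
  | zero => simpa using he
  | succ k ih =>
    simp only [OnBoard] at h h'
    push_cast at h' ⊢
    have hk : OnBoard m n (p + k) (q - k) := by simp only [OnBoard]; omega
    have := P.east_down hk (by simp only [OnBoard]; omega) (by omega) (by omega) (ih hk)
    rwa [show p + (k + 1 : ℤ) = p + k + 1 by ring, show q - (k + 1 : ℤ) = q - k - 1 by ring]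

/-- Push east down the antidiagonal to its lower right end, across the edge of the board to the
upper left end of the partner, and down again. -/
theorem east_of_east_paired (P : Ranking m n x y) {p q p' q' : ℤ} (h : OnBoard m n p q)
    (h' : OnBoard m n p' q') (hs : p + q + (p' + q') = m + n - 3) (hf : Free m n x y (p + q))
    (he : P.east p q) : P.east p' q' := by
  simp only [OnBoard, Free] at *
  rcases le_or_gt (p + q) (m - 2) with hc | hc
  · have e1 := P.east_along q.toNat (p := p) (q := q) (by simp only [OnBoard]; omega)
      (by simp only [OnBoard]; omega) hf.1 he
    rw [show q - (q.toNat : ℤ) = 0 by omega, show p + (q.toNat : ℤ) = p + q by omega] at e1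
    have e2 := P.east_cross_bottom (by simp only [OnBoard]; omega) (by omega) (by omega)
      (by omega) e1
    have e3 := P.east_along (n - 1 - q').toNat (by simp only [OnBoard]; omega)
      (by simp only [OnBoard]; omega) (by omega) e2
    rwa [show (n : ℤ) - 1 - ((n - 1 - q').toNat : ℤ) = q' by omega,
      show (m : ℤ) - 2 - (p + q) + ((n - 1 - q').toNat : ℤ) = p' by omega] at e3
  · have e1 := P.east_along (m - 1 - p).toNat (p := p) (q := q) (by simp only [OnBoard]; omega)
      (by simp only [OnBoard]; omega) hf.1 he
    rw [show p + ((m - 1 - p).toNat : ℤ) = m - 1 by omega,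
      show q - ((m - 1 - p).toNat : ℤ) = p + q - m + 1 by omega] at e1
    have e2 := P.east_cross_right (by simp only [OnBoard]; omega) (by omega) (by omega)
      (by omega) e1
    have e3 := P.east_along p'.toNat (by simp only [OnBoard]; omega)
      (by simp only [OnBoard]; omega) (by omega) e2
    rwa [show (0 : ℤ) + (p'.toNat : ℤ) = p' by omega,
      show (n : ℤ) - 2 - (p + q - m + 1) - (p'.toNat : ℤ) = q' by omega] at e3

/-- Some square of the antidiagonal `p + q = i` travels east. -/
def TravelsEast (P : Ranking m n x y) (i : ℤ) : Prop :=
  ∃ p q, OnBoard m n p q ∧ p + q = i ∧ P.east p q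

theorem exists_onBoard_sum {i : ℤ} (hm : 1 ≤ m) (hn : 1 ≤ n) (h : 0 ≤ i) (h' : i ≤ m + n - 2) :
    ∃ p q, OnBoard m n p q ∧ p + q = i := by
  refine ⟨min i (m - 1), i - min i (m - 1), ?_, by ring⟩
  simp only [OnBoard]
  omega

/-- Going to the partner and back also transports east up the antidiagonal. -/
theorem east_iff (P : Ranking m n x y) {p q : ℤ} (h : OnBoard m n p q) (hi : p + q ≤ m + n - 3)
    (hf : Free m n x y (p + q)) : P.east p q ↔ P.TravelsEast (p + q) := by
  refine ⟨fun he => ⟨p, q, h, rfl, he⟩, ?_⟩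
  rintro ⟨p₁, q₁, h1, h2, h3⟩
  obtain ⟨p₂, q₂, h4, h5⟩ := exists_onBoard_sum (m := m) (n := n) (i := m + n - 3 - (p + q))
    (by simp only [OnBoard] at *; omega) (by simp only [OnBoard] at *; omega) (by omega)
    (by simp only [OnBoard] at *; omega)
  have e1 := P.east_of_east_paired h1 h4 (by omega) (by rwa [h2]) h3
  exact P.east_of_east_paired h4 h (by omega) (by simp only [Free] at *; omega) e1

theorem travelsEast_paired (P : Ranking m n x y) {i i' : ℤ} (hm : 1 ≤ m) (hn : 1 ≤ n) (h : 0 ≤ i)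
    (h' : 0 ≤ i') (hs : i + i' = m + n - 3) (hf : Free m n x y i) :
    P.TravelsEast i ↔ P.TravelsEast i' := by
  obtain ⟨p, q, h1, rfl⟩ := exists_onBoard_sum (m := m) (n := n) hm hn h (by omega)
  obtain ⟨p', q', h2, rfl⟩ := exists_onBoard_sum (m := m) (n := n) hm hn h' (by omega)
  have hf' : Free m n x y (p' + q') := by simp only [Free] at *; omega
  rw [← P.east_iff h1 (by omega) hf, ← P.east_iff h2 (by omega) hf']
  exact ⟨P.east_of_east_paired h1 h2 hs hf, P.east_of_east_paired h2 h1 (by omega) hf'⟩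

theorem step_east (P : Ranking m n x y) {p q : ℤ} (h : OnBoard m n p q) (hi : p + q ≤ m + n - 3)
    (hf : Free m n x y (p + q)) (hd : P.TravelsEast (p + q)) (hp : p + 1 < m) :
    P.rank (p + 1) q = P.rank p q + 1 ∧
      P.rank (m - 1 - p) (n - 1 - q) = P.rank (m - 1 - (p + 1)) (n - 1 - q) + 1 := by
  have he := (P.east_iff h hi hf).2 hd
  simp only [OnBoard, Free] at *
  refine ⟨P.east_step h (by omega) he hp, ?_⟩
  have h' : OnBoard m n (m - 1 - (p + 1)) (n - 1 - q) := by simp only [OnBoard]; omega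
  have he' := P.east_of_east_paired h h' (by omega) hf he
  have := P.east_step h' (by omega) he' (by omega)
  rwa [show (m : ℤ) - 1 - (p + 1) + 1 = m - 1 - p by ring] at this

theorem step_north (P : Ranking m n x y) {p q : ℤ} (h : OnBoard m n p q) (hi : p + q ≤ m + n - 3)
    (hf : Free m n x y (p + q)) (hd : ¬ P.TravelsEast (p + q)) (hq : q + 1 < n) :
    P.rank p (q + 1) = P.rank p q + 1 ∧
      P.rank (m - 1 - p) (n - 1 - q) = P.rank (m - 1 - p) (n - 1 - (q + 1)) + 1 := by
  have he := fun h0 => hd ((P.east_iff h hi hf).1 h0)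
  have h' : OnBoard m n (m - 1 - p) (n - 1 - (q + 1)) := by simp only [OnBoard] at *; omega
  have he' : ¬ P.east (m - 1 - p) (n - 1 - (q + 1)) := fun h0 =>
    he (P.east_of_east_paired h' h (by ring) (by simp only [Free] at *; omega) h0)
  simp only [OnBoard, Free] at *
  refine ⟨P.north_step h (by omega) he hq, ?_⟩
  have := P.north_step h' (by omega) he' (by omega)
  rwa [show (n : ℤ) - 1 - (q + 1) + 1 = n - 1 - q by ring] at this

/-- Leaving from the edge by either move lands on the opposite square. -/
theorem rank_exit (P : Ranking m n x y) {p q : ℤ} (h : OnBoard m n p q) (t : ¬ (p = x ∧ q = y))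
    (h1 : P.east p q → p = m - 1) (h2 : ¬ P.east p q → q = n - 1) :
    P.rank (m - 1 - p) (n - 1 - q) = P.rank p q + 1 := by
  by_cases he : P.east p q
  · rw [← P.east_exit h t he (h1 he), h1 he, sub_self]
  · rw [← P.north_exit h t he (h2 he), h2 he, sub_self]

open Classical in
/-- The number of antidiagonals `s ≤ i < b` that travel north. -/
noncomputable def northCount (P : Ranking m n x y) (s b : ℤ) : ℤ :=
  (((Finset.Ico s b).filter fun i => ¬ P.TravelsEast i).card : ℤ)

theorem northCount_nonneg (P : Ranking m n x y) (s b : ℤ) : 0 ≤ P.northCount s b :=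
  Int.natCast_nonneg _

theorem northCount_add (P : Ranking m n x y) {s t b : ℤ} (h : s ≤ t) (h' : t ≤ b) :
    P.northCount s b = P.northCount s t + P.northCount t b := by
  classical
  unfold northCount
  rw [← Finset.Ico_union_Ico_eq_Ico h h', Finset.filter_union, Finset.card_union_of_disjoint]
  · push_cast
    rfl
  · exact Finset.disjoint_filter_filter (Finset.Ico_disjoint_Ico_consecutive s t b)

theorem northCount_self (P : Ranking m n x y) (s : ℤ) : P.northCount s s = 0 := by
  simp [northCount]

theorem northCount_le (P : Ranking m n x y) {s b : ℤ} (h : s ≤ b) : P.northCount s b ≤ b - s := by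
  classical
  unfold northCount
  have := Finset.card_filter_le (Finset.Ico s b) fun i => ¬ P.TravelsEast i
  rw [Int.card_Ico] at this
  omega

theorem northCount_succ_of_east (P : Ranking m n x y) {s b : ℤ} (h : s < b) (hd : P.TravelsEast s) :
    P.northCount s b = P.northCount (s + 1) b := by
  rw [P.northCount_add (t := s + 1) (by omega) (by omega)]
  have : Finset.Ico s (s + 1) = {s} := by ext; simp; omega
  simp [northCount, this, Finset.filter_singleton, hd]

theorem northCount_succ_of_north (P : Ranking m n x y) {s b : ℤ} (h : s < b)
    (hd : ¬ P.TravelsEast s) : P.northCount s b = 1 + P.northCount (s + 1) b := by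
  rw [P.northCount_add (t := s + 1) (by omega) (by omega)]
  have : Finset.Ico s (s + 1) = {s} := by ext; simp; omega
  simp [northCount, this, Finset.filter_singleton, hd]

theorem northCount_paired (P : Ranking m n x y) {s t : ℤ} (hm : 1 ≤ m) (hn : 1 ≤ n) (hs : 0 ≤ s)
    (ht : t ≤ m + n - 2) (hf : ∀ i, s ≤ i → i < t → Free m n x y i) :
    P.northCount (m + n - 2 - t) (m + n - 2 - s) = P.northCount s t := by
  classical
  unfold northCount
  congr 1
  refine Finset.card_bij (fun i _ => m + n - 3 - i) ?_ ?_ ?_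
  · intro i hi
    simp only [Finset.mem_filter, Finset.mem_Ico] at hi ⊢
    refine ⟨by omega, fun h => hi.2 ?_⟩
    exact (P.travelsEast_paired hm hn (by omega) (by omega) (by ring)
      (hf _ (by omega) (by omega))).1 h
  · intro i _ j _ hij
    omega
  · intro i hi
    simp only [Finset.mem_filter, Finset.mem_Ico] at hi
    refine ⟨m + n - 3 - i, ?_, by ring⟩
    simp only [Finset.mem_filter, Finset.mem_Ico]
    refine ⟨by omega, fun h => hi.2 ?_⟩
    exact (P.travelsEast_paired hm hn (by omega) (by omega) (by ring)
      (hf _ (by omega) (by omega))).2 h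

theorem exists_first_north (P : Ranking m n x y) {s b : ℤ} (k : ℕ) (hk : s + k = b)
    (h : P.northCount s b ≠ 0) :
    ∃ i, s ≤ i ∧ i < b ∧ ¬ P.TravelsEast i ∧ P.northCount s i = 0 := by
  induction k generalizing s with
  | zero =>
    rw [show b = s by push_cast at hk; omega, northCount_self] at h
    exact absurd rfl h
  | succ k ih =>
    push_cast at hk
    by_cases hd : P.TravelsEast s
    · rw [P.northCount_succ_of_east (by omega) hd] at h
      obtain ⟨i, h1, h2, h3, h4⟩ := ih (by omega) h
      refine ⟨i, by omega, h2, h3, ?_⟩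
      rwa [P.northCount_succ_of_east (by omega) hd]
    · exact ⟨s, le_rfl, by omega, hd, P.northCount_self s⟩

/-- From a square one either follows a lattice path up to a later antidiagonal, or leaves the board
and returns to the opposite square. -/
theorem rank_trace (P : Ranking m n x y) {p q : ℤ} (k : ℕ) (h : OnBoard m n p q)
    (hf : ∀ i, p + q ≤ i → i < p + q + k → Free m n x y i) (hk : p + q + k ≤ m + n - 2) :
    (p + (k - P.northCount (p + q) (p + q + k)) < m ∧ q + P.northCount (p + q) (p + q + k) < n →
      P.rank (p + (k - P.northCount (p + q) (p + q + k))) (q + P.northCount (p + q) (p + q + k)) =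
        P.rank p q + k) ∧
    (¬ (p + (k - P.northCount (p + q) (p + q + k)) < m ∧
        q + P.northCount (p + q) (p + q + k) < n) →
      P.rank p q < P.rank (m - 1 - p) (n - 1 - q)) := by
  induction k generalizing p q with
  | zero =>
    simp only [OnBoard] at h
    simp only [Nat.cast_zero, add_zero, northCount_self, sub_zero]
    exact ⟨fun _ => trivial, fun h' => by omega⟩
  | succ k ih =>
    push_cast at hf hk ⊢
    have hf0 := hf (p + q) le_rfl (by omega)
    have hb := h
    simp only [OnBoard] at hb
    have hN := P.northCount_nonneg (p + q + 1) (p + q + (k + 1))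
    have hN' := P.northCount_le (s := p + q + 1) (b := p + q + (k + 1)) (by omega)
    by_cases hd : P.TravelsEast (p + q)
    · rw [P.northCount_succ_of_east (by omega) hd]
      by_cases hp : p + 1 < m
      -- The opposite of the next square immediately precedes the opposite of this one, so the
      -- inequality for the next square passes to this one.
      · obtain ⟨e1, e2⟩ := P.step_east h (by omega) hf0 hd hp
        have hi := ih (p := p + 1) (q := q) (by simp only [OnBoard]; omega)
          (fun i _ _ => hf i (by omega) (by omega)) (by omega)
        rw [show p + 1 + q = p + q + 1 by ring,
          show p + q + 1 + (k : ℤ) = p + q + (k + 1) by ring, e1] at hi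
        set N := P.northCount (p + q + 1) (p + q + (k + 1))
        rw [show p + 1 + ((k : ℤ) - N) = p + (k + 1 - N) by ring] at hi
        refine ⟨fun hh => ?_, fun hh => ?_⟩
        · rw [hi.1 hh]
          omega
        · have := hi.2 hh
          omega
      · refine ⟨fun hh => by omega, fun _ => ?_⟩
        have he := (P.east_iff h (by omega) hf0).2 hd
        rw [P.rank_exit h (by simp only [Free] at hf0; omega) (fun _ => by omega)
          (fun h' => absurd he h')]
        omega
    · rw [P.northCount_succ_of_north (by omega) hd]
      by_cases hq : q + 1 < n
      · obtain ⟨e1, e2⟩ := P.step_north h (by omega) hf0 hd hq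
        have hi := ih (p := p) (q := q + 1) (by simp only [OnBoard]; omega)
          (fun i _ _ => hf i (by omega) (by omega)) (by omega)
        rw [show p + (q + 1) = p + q + 1 by ring,
          show p + q + 1 + (k : ℤ) = p + q + (k + 1) by ring, e1] at hi
        set N := P.northCount (p + q + 1) (p + q + (k + 1))
        rw [show p + ((k : ℤ) - N) = p + (k + 1 - (1 + N)) by ring,
          show q + 1 + N = q + (1 + N) by ring] at hi
        refine ⟨fun hh => ?_, fun hh => ?_⟩
        · rw [hi.1 hh]
          omega
        · have := hi.2 hh
          omega
      · refine ⟨fun hh => by omega, fun _ => ?_⟩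
        have he := fun h0 => hd ((P.east_iff h (by omega) hf0).1 h0)
        rw [P.rank_exit h (by simp only [Free] at hf0; omega) (fun h' => absurd h' he)
          (fun _ => by omega)]
        omega

/-- Above the last rail the path cannot avoid leaving the board, so the second alternative of
`rank_trace` always occurs. -/
theorem rank_lt_opposite (P : Ranking m n x y) {p q : ℤ} (k : ℕ) (h : OnBoard m n p q)
    (hf : ∀ i, p + q ≤ i → i ≤ m + n - 2 → Free m n x y i) (hk : p + q + k = m + n - 2) :
    P.rank p q < P.rank (m - 1 - p) (n - 1 - q) := by
  induction k generalizing p q with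
  | zero =>
    have hf0 := hf (p + q) le_rfl (by omega)
    simp only [OnBoard, Free] at h hf0
    rw [P.rank_exit (by simp only [OnBoard]; omega) (by omega) (fun _ => by omega)
      (fun _ => by omega)]
    omega
  | succ k ih =>
    push_cast at hk
    have hf0 := hf (p + q) le_rfl (by omega)
    have hb := h
    simp only [OnBoard] at hb
    have ht : ¬ (p = x ∧ q = y) := by simp only [Free] at hf0; omega
    by_cases hd : P.TravelsEast (p + q)
    · by_cases hp : p + 1 < m
      · obtain ⟨e1, e2⟩ := P.step_east h (by omega) hf0 hd hp
        have := ih (p := p + 1) (q := q) (by simp only [OnBoard]; omega)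
          (fun i _ _ => hf i (by omega) (by omega)) (by omega)
        omega
      · have he := (P.east_iff h (by omega) hf0).2 hd
        rw [P.rank_exit h ht (fun _ => by omega) (fun h' => absurd he h')]
        omega
    · by_cases hq : q + 1 < n
      · obtain ⟨e1, e2⟩ := P.step_north h (by omega) hf0 hd hq
        have := ih (p := p) (q := q + 1) (by simp only [OnBoard]; omega)
          (fun i _ _ => hf i (by omega) (by omega)) (by omega)
        omega
      · have he := fun h0 => hd ((P.east_iff h (by omega) hf0).1 h0)
        rw [P.rank_exit h ht (fun h' => absurd h' he) (fun _ => by omega)]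
        omega

end Ranking

end Directions

theorem region_of_row {m n : ℕ} {x y : ℤ} (hn : 3 ≤ n) (hmn : n ≤ m) (hx : x < m) (hy : y < n)
    (h1 : 2 * y < n - 2 → x = m - 1 ∨ n - 2 ≤ 2 * x ∧ 2 * x ≤ m - 1)
    (h2 : 2 * y = n - 2 → x = m - 1 ∨ 2 * x ≤ 2 * m - n)
    (h3 : 2 * y = n → m - 1 ≤ 2 * x ∨ 2 * m - n - 2 ≤ 2 * x)
    (h4 : n < 2 * y → m - 1 ≤ 2 * x ∨ y = n - 1) (h5 : n < 2 * y → 2 * x ≤ 2 * m - n) :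
    (x = m - 1 ∧ y ≤ n / 2) ∨ (x ≤ m - (n + 1) / 2 ∧ y = n - 1) ∨
      (x ≤ m / 2 - 1 ∧ y = (n - 1) / 2) ∨ (m - n / 2 - 1 ≤ x ∧ y = n / 2) ∨
      ((n - 1) / 2 ≤ x ∧ x ≤ (m - 1) / 2 ∧ y ≤ (n - 1) / 2 - 1) ∨
      (m / 2 ≤ x ∧ x ≤ m - (n + 1) / 2 ∧ (n - 1) / 2 ≤ y) := by
  rcases lt_trichotomy (2 * y) (n - 2) with hc | hc | hc
  · have := h1 hc
    clear h1 h2 h3 h4 h5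
    omega
  · have := h2 hc
    clear h1 h2 h3 h4 h5
    omega
  · rcases lt_trichotomy (2 * y) n with hc' | hc' | hc'
    · clear h1 h2 h3 h4 h5
      omega
    · have := h3 hc'
      clear h1 h2 h3 h4 h5
      omega
    · have a1 := h4 hc'
      have a2 := h5 hc'
      clear h1 h2 h3 h4 h5
      omega

/-! ### The two rails and the position of the terminal square -/

section TwoRails

/-- The terminal square lies on one of the antidiagonals `p + q = a` and `p + q = m + n - 3 - a`,
where `a < m + n - 3 - a`. -/
structure TwoRails (m n : ℕ) (x y a : ℤ) : Prop where
  three_le : 3 ≤ n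
  le : n ≤ m
  neg_one_le : -1 ≤ a
  lt : 2 * a < m + n - 3
  mem : x + y = a ∨ x + y = m + n - 3 - a

variable {m n : ℕ} {x y a : ℤ}

namespace TwoRails

theorem free (h : TwoRails m n x y a) {i : ℤ} (h1 : i ≠ a) (h2 : i ≠ m + n - 3 - a) :
    Free m n x y i := by
  have := h.mem
  simp only [Free]
  omega

/-- A square between the two rails, or its opposite, can be traced back to the lower rail. -/
theorem trace_fits (h : TwoRails m n x y a) (P : Ranking m n x y) {p q : ℤ} (hb : OnBoard m n p q)
    (h1 : a < p + q) (h2 : p + q ≤ m + n - 3 - a) :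
    (0 ≤ q - P.northCount (a + 1) (p + q) ∧ q - P.northCount (a + 1) (p + q) ≤ a + 1) ∨
      (n - 2 - a - P.northCount (a + 1) (m + n - 3 - a) ≤ q - P.northCount (a + 1) (p + q) ∧
        q - P.northCount (a + 1) (p + q) ≤ n - 1 - P.northCount (a + 1) (m + n - 3 - a)) := by
  obtain ⟨hn, hmn, ha, hlt, -⟩ := id h
  have hb' : OnBoard m n (m - 1 - p) (n - 1 - q) := by simp only [OnBoard] at *; omega
  have e1 := (P.rank_trace (m + n - 3 - a - (p + q)).toNat hb
    (fun i _ _ => h.free (by omega) (by omega)) (by omega)).2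
  have e2 := (P.rank_trace (p + q - (a + 1)).toNat hb'
    (fun i _ _ => h.free (by omega) (by omega)) (by omega)).2
  rw [sub_sub_cancel, sub_sub_cancel] at e2
  rw [show p + q + ((m + n - 3 - a - (p + q)).toNat : ℤ) = m + n - 3 - a by omega] at e1
  rw [show (m : ℤ) - 1 - p + (n - 1 - q) = m + n - 2 - (p + q) by ring,
    show (m : ℤ) + n - 2 - (p + q) + ((p + q - (a + 1)).toNat : ℤ) = m + n - 2 - (a + 1) by omega,
    P.northCount_paired (by omega) (by omega) (by omega) (by omega)
      (fun i _ _ => h.free (by omega) (by omega))] at e2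
  have e3 := P.northCount_add (s := a + 1) (t := p + q) (b := m + n - 3 - a) (by omega) (by omega)
  -- If neither alternative holds, the square and its opposite both leave the board before the upper
  -- rail, so each precedes the other.
  by_contra hcon
  have := e1 (by omega)
  have := e2 (by omega)
  omega

/-- Apply `trace_fits` to the corner `(0, n - 1)`. Reaching back to the lower rail needs every
antidiagonal in between to go north, hence also their partners; reaching the upper rail allows no
north antidiagonal at all. -/
theorem northCount_eq_zero_or (h : TwoRails m n x y a) (P : Ranking m n x y) (ha : a ≤ n - 2) :
    P.northCount (a + 1) (m + n - 3 - a) = 0 ∨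
      P.northCount (a + 1) (n - 1) = n - 2 - a ∧
        2 * (n - 2 - a) ≤ P.northCount (a + 1) (m + n - 3 - a) ∧
        P.northCount (a + 1) (m + n - 3 - a) ≤ m + n - 4 - 2 * a := by
  obtain ⟨hn, hmn, ha', hlt, -⟩ := id h
  have e1 := h.trace_fits P (p := 0) (q := n - 1) (by simp only [OnBoard]; omega) (by omega)
    (by omega)
  rw [zero_add] at e1
  have e2 := P.northCount_add (s := a + 1) (t := n - 1) (b := m + n - 3 - a) (by omega) (by omega)
  have e3 := P.northCount_add (s := n - 1) (t := m - 1) (b := m + n - 3 - a) (by omega) (by omega)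
  have e4 := P.northCount_paired (s := a + 1) (t := n - 1) (by omega) (by omega) (by omega)
    (by omega) (fun i _ _ => h.free (by omega) (by omega))
  rw [show (m : ℤ) + n - 2 - (n - 1) = m - 1 by ring,
    show (m : ℤ) + n - 2 - (a + 1) = m + n - 3 - a by ring] at e4
  have e5 := P.northCount_le (s := a + 1) (b := n - 1) (by omega)
  have e6 := P.northCount_le (s := n - 1) (b := m - 1) (by omega)
  have e7 := P.northCount_nonneg (n - 1) (m - 1)
  have e8 := P.northCount_nonneg (a + 1) (n - 1)
  omega

/-- Just after the first north antidiagonal `i`, the bottom square `(i + 1, 0)` cannot be traced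
back, so it must fit under the upper rail. -/
theorem northCount_le (h : TwoRails m n x y a) (P : Ranking m n x y) :
    P.northCount (a + 1) (m + n - 3 - a) ≤ n := by
  obtain ⟨hn, hmn, ha', hlt, -⟩ := id h
  by_contra hcon
  obtain ⟨i, h1, h2, h3, h4⟩ := P.exists_first_north (m + n - 4 - 2 * a).toNat
    (s := a + 1) (b := m + n - 3 - a) (by omega) (by omega)
  have hi : i + 1 ≤ m - 1 := by
    rcases le_or_gt a (n - 3) with hc | hc
    · rcases h.northCount_eq_zero_or P (by omega) with h5 | ⟨h5, -, -⟩
      · omega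
      · rcases le_or_gt i (n - 2) with hi | hi
        · omega
        · have := P.northCount_add (s := a + 1) (t := n - 1) (b := i) (by omega) (by omega)
          have := P.northCount_nonneg (n - 1) i
          omega
    · omega
  have e1 := h.trace_fits P (p := i + 1) (q := 0) (by simp only [OnBoard]; omega) (by omega)
    (by omega)
  rw [add_zero, P.northCount_add (t := i) (b := i + 1) (by omega) (by omega),
    P.northCount_succ_of_north (by omega) h3, h4, P.northCount_self] at e1
  omega

/-- If all moves go east and `a` is small, row `a + 2` misses both rails. -/
theorem le_of_northCount_eq_zero (h : TwoRails m n x y a) (P : Ranking m n x y)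
    (h0 : P.northCount (a + 1) (m + n - 3 - a) = 0) : n - 4 ≤ 2 * a := by
  obtain ⟨hn, hmn, ha', hlt, -⟩ := id h
  by_contra hcon
  have e1 := h.trace_fits P (p := 0) (q := a + 2) (by simp only [OnBoard]; omega) (by omega)
    (by omega)
  have e2 := P.northCount_add (s := a + 1) (t := 0 + (a + 2)) (b := m + n - 3 - a) (by omega)
    (by omega)
  have e3 := P.northCount_nonneg (a + 1) (0 + (a + 2))
  have e4 := P.northCount_nonneg (0 + (a + 2)) (m + n - 3 - a)
  omega

theorem nonneg (h : TwoRails m n x y a) (P : Ranking m n x y) : 0 ≤ a := by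
  obtain ⟨hn, hmn, ha', hlt, -⟩ := id h
  by_contra hcon
  have := h.northCount_le P
  rcases h.northCount_eq_zero_or P (by omega) with h0 | ⟨-, h0, -⟩
  · have := h.le_of_northCount_eq_zero P h0
    omega
  · omega

theorem mirrored (h : TwoRails m n x y a) (P : Ranking m n x y) :
    Mirrored (min (a + 1) (n - 1)) (n - 1 - P.northCount (a + 1) (m + n - 3 - a))
      (fun q => P.rank (a + 1 - q) q) (fun q => P.rank (m - 2 - a + q) (n - 1 - q)) := by
  obtain ⟨hn, hmn, ha, hlt, -⟩ := id h
  intro q h0 hc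
  obtain ⟨e1, e2⟩ := P.rank_trace (p := a + 1 - q) (q := q) (m + n - 4 - 2 * a).toNat
    (by simp only [OnBoard]; omega)
    (fun i _ _ => h.free (by omega) (by omega)) (by omega)
  have hν := P.northCount_nonneg (a + 1) (m + n - 3 - a)
  rw [sub_add_cancel, show a + 1 + ((m + n - 4 - 2 * a).toNat : ℤ) = m + n - 3 - a by omega]
    at e1 e2
  set ν := P.northCount (a + 1) (m + n - 3 - a)
  refine ⟨fun hh => ?_, fun hh => ?_⟩
  · have := e1 (by omega)
    beta_reduce
    rw [show (m : ℤ) - 2 - a + (n - 1 - ν - q) =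
        a + 1 - q + ((m + n - 4 - 2 * a).toNat - ν) by omega,
      show (n : ℤ) - 1 - (n - 1 - ν - q) = q + ν by ring]
    omega
  · have := e2 (by omega)
    beta_reduce
    rw [show (m : ℤ) - 2 - a + q = m - 1 - (a + 1 - q) by ring]
    omega

theorem upper_east (h : TwoRails m n x y a) (P : Ranking m n x y) {q : ℤ} (h0 : 0 ≤ q) (h1 : q ≤ a)
    (h2 : q ≤ n - 1) (ht : ¬ (m - 2 - a + q = x ∧ n - 1 - q = y))
    (he : P.east (m - 2 - a + q) (n - 1 - q)) :
    P.rank (m - 2 - a + q) (n - 1 - q) < P.rank (a - q) q := by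
  obtain ⟨hn, hmn, ha, hlt, -⟩ := id h
  have e1 := P.east_step (by simp only [OnBoard]; omega) ht he (by omega)
  have e2 := P.rank_lt_opposite (p := m - 2 - a + q + 1) (q := n - 1 - q) a.toNat
    (by simp only [OnBoard]; omega) (fun i _ _ => h.free (by omega) (by omega)) (by omega)
  rw [sub_sub_cancel, show (m : ℤ) - 1 - (m - 2 - a + q + 1) = a - q by ring] at e2
  omega

theorem upper_north (h : TwoRails m n x y a) (P : Ranking m n x y) (ha : 0 ≤ a) {q : ℤ} (h0 : 0 < q)
    (h1 : q ≤ a + 1) (h2 : q ≤ n - 1) (ht : ¬ (m - 2 - a + q = x ∧ n - 1 - q = y))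
    (he : ¬ P.east (m - 2 - a + q) (n - 1 - q)) :
    P.rank (m - 2 - a + q) (n - 1 - q) < P.rank (a - (q - 1)) (q - 1) := by
  obtain ⟨hn, hmn, -, hlt, -⟩ := id h
  have e1 := P.north_step (by simp only [OnBoard]; omega) ht he (by omega)
  have e2 := P.rank_lt_opposite (p := m - 2 - a + q) (q := n - 1 - q + 1) a.toNat
    (by simp only [OnBoard]; omega) (fun i _ _ => h.free (by omega) (by omega)) (by omega)
  rw [show (n : ℤ) - 1 - (n - 1 - q + 1) = q - 1 by ring,
    show (m : ℤ) - 1 - (m - 2 - a + q) = a - (q - 1) by ring] at e2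
  omega

/-- A north move would leave the board beyond the upper rail, and the path would then return to this
very square. -/
theorem lower_top_east (h : TwoRails m n x y a) (P : Ranking m n x y) (ha : n - 1 ≤ a)
    (ht : ¬ (a - (n - 1) = x ∧ n - 1 = y)) : P.east (a - (n - 1)) (n - 1) := by
  obtain ⟨hn, hmn, -, hlt, -⟩ := id h
  by_contra he
  have e1 := P.north_exit (by simp only [OnBoard]; omega) ht he rfl
  have e2 := P.rank_lt_opposite (p := m - 1 - (a - (n - 1))) (q := 0) a.toNat
    (by simp only [OnBoard]; omega) (fun i _ _ => h.free (by omega) (by omega)) (by omega)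
  rw [sub_sub_cancel, sub_zero] at e2
  omega

theorem lower_east (h : TwoRails m n x y a) (P : Ranking m n x y) {q : ℤ} (h0 : 0 ≤ q) (h1 : q ≤ a)
    (h2 : q ≤ n - 1) (ht : ¬ (a - q = x ∧ q = y)) (he : P.east (a - q) q) :
    P.rank (a + 1 - q) q = P.rank (a - q) q + 1 := by
  obtain ⟨hn, hmn, -, hlt, -⟩ := id h
  rw [← P.east_step (by simp only [OnBoard]; omega) ht he (by omega), sub_add_eq_add_sub]

theorem lower_north (h : TwoRails m n x y a) (P : Ranking m n x y) {q : ℤ} (h0 : 0 ≤ q) (h1 : q ≤ a)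
    (h2 : q + 1 ≤ n - 1) (ht : ¬ (a - q = x ∧ q = y)) (he : ¬ P.east (a - q) q) :
    P.rank (a + 1 - (q + 1)) (q + 1) = P.rank (a - q) q + 1 := by
  obtain ⟨hn, hmn, -, hlt, -⟩ := id h
  rw [← P.north_step (by simp only [OnBoard]; omega) ht he (by omega), add_sub_add_right_eq_sub]

theorem zero_of_east (h : TwoRails m n x y a) (P : Ranking m n x y) {q : ℤ} (h0 : 0 ≤ q)
    (h1 : q ≤ min (a + 1) (n - 1)) (ht : ¬ (a - q = x ∧ q = y))
    (ht' : ¬ (m - 2 - a + q = x ∧ n - 1 - q = y)) (he : P.east (m - 2 - a + q) (n - 1 - q))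
    (he' : q < min (a + 1) (n - 1) → P.east (a - q) q) :
    P.rank (m - 2 - a + q) (n - 1 - q) < P.rank (a + 1 - q) q := by
  obtain ⟨hn, hmn, -, hlt, -⟩ := id h
  by_cases hq : q ≤ a
  · have hA : P.east (a - q) q := by
      by_cases hc : q < min (a + 1) (n - 1)
      · exact he' hc
      · obtain rfl : q = n - 1 := by omega
        exact h.lower_top_east P hq ht
    have e1 := h.upper_east P h0 hq (by omega) ht' he
    have e2 := h.lower_east P h0 hq (by omega) ht hA
    omega
  -- The upper square is on the right edge here, and its east move lands directly on `(0, a + 1)`.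
  · obtain rfl : q = a + 1 := by omega
    have := P.east_exit (by simp only [OnBoard]; omega) ht' he (by omega)
    rw [sub_sub_cancel] at this
    rw [sub_self]
    omega

theorem plus_of_east (h : TwoRails m n x y a) (P : Ranking m n x y) {q : ℤ} (h0 : 0 ≤ q)
    (h1 : q < min (a + 1) (n - 1)) (ht : ¬ (a - q = x ∧ q = y))
    (ht' : ¬ (m - 2 - a + q = x ∧ n - 1 - q = y)) (he : P.east (m - 2 - a + q) (n - 1 - q))
    (he' : ¬ P.east (a - q) q) :
    P.rank (m - 2 - a + q) (n - 1 - q) < P.rank (a + 1 - (q + 1)) (q + 1) := by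
  have e1 := h.upper_east P h0 (by omega) (by omega) ht' he
  have e2 := h.lower_north P h0 (by omega) (by omega) ht he'
  omega

theorem zero_of_north (h : TwoRails m n x y a) (P : Ranking m n x y) (ha : 0 ≤ a) {q : ℤ}
    (h0 : 0 ≤ q) (h1 : q ≤ min (a + 1) (n - 1)) (ht : ¬ (a - (q - 1) = x ∧ q - 1 = y))
    (ht' : ¬ (m - 2 - a + q = x ∧ n - 1 - q = y)) (he : ¬ P.east (m - 2 - a + q) (n - 1 - q))
    (he' : 0 < q → ¬ P.east (a - (q - 1)) (q - 1)) :
    P.rank (m - 2 - a + q) (n - 1 - q) < P.rank (a + 1 - q) q := by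
  obtain ⟨hn, hmn, -, hlt, -⟩ := id h
  by_cases hq : 0 < q
  · have e1 := h.upper_north P ha hq (by omega) (by omega) ht' he
    have e2 := h.lower_north P (by omega) (by omega) (by omega) ht (he' hq)
    rw [sub_add_cancel] at e2
    omega
  · obtain rfl : q = 0 := by omega
    simp only [add_zero, sub_zero] at *
    have := P.north_exit (by simp only [OnBoard]; omega) ht' he rfl
    rw [show (m : ℤ) - 1 - (m - 2 - a) = a + 1 by ring] at this
    omega

theorem minus_of_north (h : TwoRails m n x y a) (P : Ranking m n x y) (ha : 0 ≤ a) {q : ℤ}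
    (h0 : 0 < q) (h1 : q ≤ min (a + 1) (n - 1)) (ht : ¬ (a - (q - 1) = x ∧ q - 1 = y))
    (ht' : ¬ (m - 2 - a + q = x ∧ n - 1 - q = y)) (he : ¬ P.east (m - 2 - a + q) (n - 1 - q))
    (he' : P.east (a - (q - 1)) (q - 1)) :
    P.rank (m - 2 - a + q) (n - 1 - q) < P.rank (a + 1 - (q - 1)) (q - 1) := by
  have e1 := h.upper_north P ha h0 (by omega) (by omega) ht' he
  have e2 := h.lower_east P (by omega) (by omega) (by omega) ht he'
  omega

theorem lower_propagate (h : TwoRails m n x y a) (P : Ranking m n x y) {q : ℤ} (h0 : 0 < q)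
    (h1 : q ≤ a) (h2 : q ≤ n - 1) (ht : ¬ (a - q = x ∧ q = y))
    (ht' : ¬ (a - (q - 1) = x ∧ q - 1 = y))
    (he : P.east (a - q) q) : P.east (a - (q - 1)) (q - 1) := by
  obtain ⟨hn, hmn, -, hlt, -⟩ := id h
  have e : a - q + 1 = a - (q - 1) := by ring
  have := P.east_down (by simp only [OnBoard]; omega) (by simp only [OnBoard]; omega) ht
    (by rwa [e]) he
  rwa [e] at this

theorem upper_propagate (h : TwoRails m n x y a) (P : Ranking m n x y) {q : ℤ} (h0 : 0 ≤ q)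
    (h1 : q < min (a + 1) (n - 1)) (ht : ¬ (m - 2 - a + q = x ∧ n - 1 - q = y))
    (ht' : ¬ (m - 2 - a + (q + 1) = x ∧ n - 1 - (q + 1) = y))
    (he : P.east (m - 2 - a + q) (n - 1 - q)) : P.east (m - 2 - a + (q + 1)) (n - 1 - (q + 1)) := by
  obtain ⟨hn, hmn, -, hlt, -⟩ := id h
  rw [← add_assoc, ← sub_sub] at *
  exact P.east_down (by simp only [OnBoard]; omega) (by simp only [OnBoard]; omega) ht ht' he

theorem lower_to_upper (h : TwoRails m n x y a) (P : Ranking m n x y) (ha : 0 ≤ a)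
    (ht : ¬ (a - 0 = x ∧ 0 = y)) (ht' : ¬ (m - 2 - a + 0 = x ∧ n - 1 - 0 = y))
    (he : P.east (a - 0) 0) : P.east (m - 2 - a + 0) (n - 1 - 0) := by
  obtain ⟨hn, hmn, -, hlt, -⟩ := id h
  rw [sub_zero, add_zero] at *
  exact P.east_cross_bottom (by simp only [OnBoard]; omega) (by omega) ht ht' he

theorem upper_to_lower (h : TwoRails m n x y a) (P : Ranking m n x y) (ha : 0 ≤ a) {c : ℤ}
    (hc : c = min (a + 1) (n - 1)) (ht : ¬ (m - 2 - a + c = x ∧ n - 1 - c = y))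
    (ht' : ¬ (a - (c - 1) = x ∧ c - 1 = y)) (ht2 : n - 1 ≤ a → ¬ (a - (n - 1) = x ∧ n - 1 = y))
    (he : P.east (m - 2 - a + c) (n - 1 - c)) : P.east (a - (c - 1)) (c - 1) := by
  obtain ⟨hn, hmn, -, hlt, -⟩ := id h
  by_cases hca : n - 1 ≤ a
  · obtain rfl : c = n - 1 := by omega
    exact h.lower_propagate P (by omega) hca le_rfl (ht2 hca) ht' (h.lower_top_east P hca (ht2 hca))
  · obtain rfl : c = a + 1 := by omega
    have e : (m : ℤ) - 2 - a + (a + 1) = m - 1 := by ring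
    rw [e] at ht he
    have e2 : (n : ℤ) - 2 - (n - 1 - (a + 1)) = a := by ring
    have := P.east_cross_right (by simp only [OnBoard]; omega) (by omega) ht
      (by rw [e2]; omega) he
    rw [e2] at this
    rwa [add_sub_cancel_right, sub_self]

theorem terminal_of_upper (h : TwoRails m n x y a) (P : Ranking m n x y) (hb : OnBoard m n x y)
    (hs : x + y = m + n - 3 - a) {c t : ℤ} (hc : c = min (a + 1) (n - 1))
    (ht : t = n - 1 - P.northCount (a + 1) (m + n - 3 - a)) (h1 : -1 ≤ t) (h2 : t ≤ 2 * c + 1) :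
    (t ≤ c ∧ (2 * (n - 1 - y) = t ∨ 2 * (n - 1 - y) = t + 1)) ∨ (c ≤ t ∧ y = n - 1) ∨
      a ≤ n - 2 ∧ ((c ≤ t ∧ (2 * (n - 1 - y) = t ∨ 2 * (n - 1 - y) = t - 1)) ∨
        (t ≤ c ∧ n - 1 - y = c)) := by
  obtain ⟨hn, hmn, -, hlt, -⟩ := id h
  have ha := h.nonneg P
  have hM := h.mirrored P
  rw [← hc, ← ht] at hM
  simp only [OnBoard] at hb
  have hT := hM.terminal_on_upper (y := n - 1 - y) (eA := fun q => P.east (a - q) q)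
    (eB := fun q => P.east (m - 2 - a + q) (n - 1 - q)) h1 h2 (by omega) (by omega) (by omega)
    (fun q _ _ _ he he' => h.zero_of_east P (by omega) (by omega) (by omega) (by omega) he
      (by rwa [← hc]))
    (fun q _ _ _ he he' => h.plus_of_east P (by omega) (by omega) (by omega) (by omega) he he')
    (fun q _ _ _ he he' => h.zero_of_north P ha (by omega) (by omega) (by omega) (by omega) he he')
    (fun q _ _ _ he he' => h.minus_of_north P ha (by omega) (by omega) (by omega) (by omega) he he')
    (fun q _ _ he => h.lower_propagate P (by omega) (by omega) (by omega) (by omega) (by omega) he)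
    (fun _ he => h.lower_to_upper P ha (by omega) (by omega) he)
    (fun q _ _ _ _ he => h.upper_propagate P (by omega) (by omega) (by omega) (by omega) he)
    (fun _ he => h.upper_to_lower P ha hc (by omega) (by omega) (by omega) he)
  -- When the lower rail reaches the top row, its top square goes east and so does the one below,
  -- which rules out the second alternative.
  by_cases hca : n - 1 ≤ a
  · obtain rfl : c = n - 1 := by omega
    have := h.lower_propagate P (by omega) hca le_rfl (by omega) (by omega)
      (h.lower_top_east P hca (by omega))
    rcases hT with hT | ⟨hT, -⟩
    · omega
    · exact absurd this hT
  · omega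

theorem terminal_of_lower (h : TwoRails m n x y a) (P : Ranking m n x y) (hb : OnBoard m n x y)
    (hs : x + y = a) {c t : ℤ} (hc : c = min (a + 1) (n - 1)) (hyc : y < c)
    (ht : t = n - 1 - P.northCount (a + 1) (m + n - 3 - a)) (h1 : -1 ≤ t) (h2 : t ≤ 2 * c + 1) :
    (t ≤ c ∧ (2 * (y + 1) = t ∨ 2 * (y + 1) = t + 1)) ∨
      (c ≤ t ∧ (2 * y = t ∨ 2 * y = t - 1)) := by
  obtain ⟨hn, hmn, -, hlt, -⟩ := id h
  have ha := h.nonneg P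
  have hM := h.mirrored P
  rw [← hc, ← ht] at hM
  simp only [OnBoard] at hb
  exact hM.terminal_on_lower (eA := fun q => P.east (a - q) q)
    (eB := fun q => P.east (m - 2 - a + q) (n - 1 - q)) h1 h2 (by omega) (by omega)
    (fun q _ _ _ he he' => h.zero_of_east P (by omega) (by omega) (by omega) (by omega) he
      (by rwa [← hc]))
    (fun q _ _ _ he he' => h.plus_of_east P (by omega) (by omega) (by omega) (by omega) he he')
    (fun q _ _ _ he he' => h.zero_of_north P ha (by omega) (by omega) (by omega) (by omega) he he')
    (fun q _ _ _ he he' => h.minus_of_north P ha (by omega) (by omega) (by omega) (by omega) he he')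
    (fun q _ _ _ _ he =>
      h.lower_propagate P (by omega) (by omega) (by omega) (by omega) (by omega) he)
    (fun _ he => h.lower_to_upper P ha (by omega) (by omega) he)
    (fun q _ _ he => h.upper_propagate P (by omega) (by omega) (by omega) (by omega) he)
    (fun _ he => h.upper_to_lower P ha hc (by omega) (by omega) (by omega) he)

theorem terminal_mem (h : TwoRails m n x y a) (P : Ranking m n x y) (hb : OnBoard m n x y) :
    (x = m - 1 ∧ y ≤ n / 2) ∨ (x ≤ m - (n + 1) / 2 ∧ y = n - 1) ∨
      (x ≤ m / 2 - 1 ∧ y = (n - 1) / 2) ∨ (m - n / 2 - 1 ≤ x ∧ y = n / 2) ∨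
      ((n - 1) / 2 ≤ x ∧ x ≤ (m - 1) / 2 ∧ y ≤ (n - 1) / 2 - 1) ∨
      (m / 2 ≤ x ∧ x ≤ m - (n + 1) / 2 ∧ (n - 1) / 2 ≤ y) := by
  obtain ⟨hn, hmn, -, hlt, hmem⟩ := id h
  have ha := h.nonneg P
  obtain ⟨c, hc⟩ : ∃ c, c = min (a + 1) ((n : ℤ) - 1) := ⟨_, rfl⟩
  obtain ⟨t, ht⟩ : ∃ t, t = n - 1 - P.northCount (a + 1) (m + n - 3 - a) := ⟨_, rfl⟩
  have f1 := h.northCount_le P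
  have f2 := P.northCount_nonneg (a + 1) (m + n - 3 - a)
  have f3 := P.northCount_le (s := a + 1) (b := m + n - 3 - a) (by omega)
  have f4 := h.le_of_northCount_eq_zero P
  have f5 := h.northCount_eq_zero_or P
  have f6 : a ≤ n - 2 →
      t = n - 1 ∨ 2 * (n - 2 - a) ≤ n - 1 - t ∧ n - 1 - t ≤ m + n - 4 - 2 * a := by
    omega
  have f7 : t = n - 1 → n - 4 ≤ 2 * a := by omega
  have f8 : -1 ≤ t ∧ t ≤ n - 1 ∧ 2 * a + 3 - m ≤ t := by omega
  have g1 := fun hs => h.terminal_of_upper P hb hs hc ht (by omega) (by omega)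
  have g2 := fun hs hyc => h.terminal_of_lower P hb hs hc hyc ht (by omega) (by omega)
  clear f1 f2 f3 f4 f5 ht
  simp only [OnBoard] at hb
  rcases hmem with hs | hs
  -- On the lower rail `y ≤ a`, so `y ≥ c` forces `y = n - 1`, and the bound on `a` puts `x` in the
  -- top region.
  · by_cases hyc : y < c
    · have hT := g2 hs hyc
      clear g1 g2
      apply region_of_row <;> omega
    · omega
  · have hT := g1 hs
    clear g1 g2
    rcases hT with ⟨hT', hT⟩ | ⟨hT', hT⟩ | ⟨hT', hT⟩ <;> apply region_of_row <;> omega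

end TwoRails

/-- Every antidiagonal above this one is free, so each move off the rail leads to the opposite of
the square it enters, which is again on the rail. -/
theorem Ranking.terminal_mem_of_self_paired (P : Ranking m n x y) (hn : 3 ≤ n) (hmn : n ≤ m)
    (hb : OnBoard m n x y) (hs : 2 * (x + y) = m + n - 3) :
    y = n - 1 ∨ 2 * y = n - 1 ∨ 2 * y = n - 2 := by
  obtain ⟨a, ha⟩ : ∃ a, a = x + y := ⟨_, rfl⟩
  have hf : ∀ i, a < i → Free m n x y i := fun i _ => by simp only [Free]; omega
  simp only [OnBoard] at hb
  refine terminal_on_single_rail (A := fun q => P.rank (a - q) q)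
    (eA := fun q => P.east (a - q) q) hb.2.2.1 hb.2.2.2 ?_ ?_ ?_ ?_
  · intro q _ _ _ he
    have e1 := P.east_step (by simp only [OnBoard]; omega) (by omega) he (by omega)
    have e2 := P.rank_lt_opposite (p := a - q + 1) (q := q) a.toNat
      (by simp only [OnBoard]; omega) (fun i _ _ => hf i (by omega)) (by omega)
    rw [show (m : ℤ) - 1 - (a - q + 1) = a - (n - 1 - q) by omega] at e2
    omega
  · intro q _ _ _ he
    have e1 := P.north_step (by simp only [OnBoard]; omega) (by omega) he (by omega)
    have e2 := P.rank_lt_opposite (p := a - q) (q := q + 1) a.toNat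
      (by simp only [OnBoard]; omega) (fun i _ _ => hf i (by omega)) (by omega)
    rw [show (m : ℤ) - 1 - (a - q) = a - (n - 2 - q) by omega,
      show (n : ℤ) - 1 - (q + 1) = n - 2 - q by ring] at e2
    omega
  · intro _
    by_contra he
    have e1 := P.north_exit (by simp only [OnBoard]; omega) (by omega) he rfl
    have e2 := P.rank_lt_opposite (p := m - 1 - (a - (n - 1))) (q := 0) a.toNat
      (by simp only [OnBoard]; omega) (fun i _ _ => hf i (by omega)) (by omega)
    rw [sub_sub_cancel, sub_zero] at e2
    omega
  · intro q _ _ _ _ he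
    have e : a - q + 1 = a - (q - 1) := by ring
    have := P.east_down (by simp only [OnBoard]; omega) (by simp only [OnBoard]; omega) (by omega)
      (by omega) he
    rwa [e] at this

theorem Ranking.terminal_mem (P : Ranking m n x y) (hn : 3 ≤ n) (hmn : n ≤ m)
    (hb : OnBoard m n x y) :
    (x = m - 1 ∧ y ≤ n / 2) ∨ (x ≤ m - (n + 1) / 2 ∧ y = n - 1) ∨
      (x ≤ m / 2 - 1 ∧ y = (n - 1) / 2) ∨ (m - n / 2 - 1 ≤ x ∧ y = n / 2) ∨
      ((n - 1) / 2 ≤ x ∧ x ≤ (m - 1) / 2 ∧ y ≤ (n - 1) / 2 - 1) ∨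
      (m / 2 ≤ x ∧ x ≤ m - (n + 1) / 2 ∧ (n - 1) / 2 ≤ y) := by
  have hb' := hb
  simp only [OnBoard] at hb'
  rcases lt_trichotomy (2 * (x + y)) (m + n - 3 : ℤ) with hs | hs | hs
  · exact TwoRails.terminal_mem (a := x + y) ⟨hn, hmn, by omega, by omega, by omega⟩ P hb
  · have := P.terminal_mem_of_self_paired hn hmn hb hs
    omega
  · exact TwoRails.terminal_mem (a := m + n - 3 - (x + y)) ⟨hn, hmn, by omega, by omega, by omega⟩ P
      hb

end TwoRails

theorem mainTheorem2 (m n : ℕ) (hn : 3 ≤ n) (hmn : n ≤ m) (x : Fin m) (y : Fin n) :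
    (∃ l : List (Fin m × Fin n),
        IsHamiltonianPath (projectiveCheckerboard m n) l ∧ l.getLast? = some (x, y)) ↔
      ((x : ℕ) = m - 1 ∧ (y : ℕ) ≤ n / 2) ∨
      ((x : ℕ) ≤ m - (n + 1) / 2 ∧ (y : ℕ) = n - 1) ∨
      ((x : ℕ) ≤ m / 2 - 1 ∧ (y : ℕ) = (n - 1) / 2) ∨
      (m - n / 2 - 1 ≤ (x : ℕ) ∧ (x : ℕ) ≤ m - 1 ∧ (y : ℕ) = n / 2) ∨
      ((n - 1) / 2 ≤ (x : ℕ) ∧ (x : ℕ) ≤ (m - 1) / 2 ∧ (y : ℕ) ≤ (n - 1) / 2 - 1) ∨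
      (m / 2 ≤ (x : ℕ) ∧ (x : ℕ) ≤ m - (n + 1) / 2 ∧
        (n - 1) / 2 ≤ (y : ℕ) ∧ (y : ℕ) ≤ n - 1) := by
  have : NeZero m := ⟨by omega⟩
  have : NeZero n := ⟨by omega⟩
  have hx := x.isLt
  have hy := y.isLt
  have hb : OnBoard m n ((x : ℕ) : ℤ) ((y : ℕ) : ℤ) := by simp only [OnBoard]; omega
  have key : (∃ l : List (Fin m × Fin n),
      IsHamiltonianPath (projectiveCheckerboard m n) l ∧ l.getLast? = some (x, y)) ↔
        IsTerminal m n ((x : ℕ) : ℤ) ((y : ℕ) : ℤ) := by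
    unfold IsTerminal
    rw [square_coe (x, y)]
  rw [key]
  constructor
  · intro h
    obtain ⟨P⟩ := nonempty_ranking hb h
    have := P.terminal_mem hn hmn hb
    omega
  · rintro (h | h | h | h | h | h)
    · exact isTerminal_right hn hmn (by omega) (by omega) (by omega)
    · exact isTerminal_top hn hmn (by omega) (by omega) (by omega)
    · exact isTerminal_lower_middle hn hmn (by omega) (by omega) (by omega)
    · exact isTerminal_upper_middle hn hmn (by omega) (by omega) (by omega)
    · exact isTerminal_lower_block hn hmn (by omega) (by omega) (by omega) (by omega)
    -- The lowest row of the sixth region belongs to the all-east construction.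
    · by_cases hy' : (y : ℕ) = (n - 1) / 2
      · exact isTerminal_lower_middle hn hmn (by omega) (by omega) (by omega)
      · exact isTerminal_upper_block hn hmn (by omega) (by omega) (by omega) (by omega)
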